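/- Let $m_1,m_2\in\mathbb{N}=\{0,1,2,\dots\}$ with $m_1$ odd and $m_2$ even, and let $y_0<0$. Consider the operator $$\mathcal{O}u=-y^{m_1}u_{xx}-x^{m_2}u_{yy}$$ and the points $A=(0,2y_0)$, $B=(0,0)$. In $\{x\ge 0,\ y\le 0\}$ let $$AC=\Big\{0\le x\le x_C,\ \tfrac{2}{m_1+2}\Big[(-2y_0)^{\frac{m_1+2}{2}}-(-y)^{\frac{m_1+2}{2}}\Big]=\tfrac{2}{m_2+2}x^{\frac{m_2+2}{2}}\Big\},$$ $$BC=\Big\{0\le x\le x_C,\ \tfrac{2}{m_1+2}(-y)^{\frac{m_1+2}{2}}=\tfrac{2}{m_2+2}x^{\frac{m_2+2}{2}}\Big\},\qquad x_C=\Big[\tfrac12\,\tfrac{m_2+2}{m_1+2}(-2y_0)^{\frac{m_1+2}{2}}\Big]^{\frac{2}{m_2+2}},$$ be the arcs of the characteristic curves of $\mathcal{O}$ from $A$ and from $B$ to their common point $C$, and let $\sigma_3=\{x=0,\ 2y_0\le y\le 0\}$. Let $\Omega_4$ be the characteristic triangle, i.e. the bounded open region enclosed by $\sigma_3\cup AC\cup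 BC$. Suppose that $\Omega_4$ is star-shaped with respect to the vector field $D=-(m_1+2)x\,\partial_x-(m_2+2)y\,\partial_y$, that is, for every $(x,y)\in\overline{\Omega_4}$ the points $(xe^{-(m_1+2)t},ye^{-(m_2+2)t})$, $t\ge 0$, and their limit $(0,0)$ as $t\to+\infty$ belong to $\overline{\Omega_4}$. Let $$2^*(m_1,m_2)=\frac{2(m_1+m_2)+8}{m_1+m_2+m_1m_2}\qquad\text{and}\qquad \alpha>2^*(m_1,m_2)-1 .$$ If $u\in C^2(\overline{\Omega_4})$ (that is, $u$ is $C^2$ in $\Omega_4$, and $u$ and its partial derivatives of order at most two extend continuously to $\overline{\Omega_4}$) satisfies $$\mathcal{O}u=u|u|^{\alpha-1}\ \text{ in }\Omega_4,\qquad u=0\ \text{ on } AC\cup\sigma_3,$$ where the right-hand side is read as $0$ at points with $u=0$, then $u\equiv 0$ in $\Omega_4$. -/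

import Mathlib

namespace Tricomi

noncomputable section

/-- First partial derivative in the first variable of a function on the plane. -/
def dx (u : ℝ × ℝ → ℝ) (z : ℝ × ℝ) : ℝ := fderiv ℝ u z (1, 0)

/-- First partial derivative in the second variable of a function on the plane. -/
def dy (u : ℝ × ℝ → ℝ) (z : ℝ × ℝ) : ℝ := fderiv ℝ u z (0, 1)

/-- The operator `u ↦ - y ^ m₁ u_xx - x ^ m₂ u_yy`. -/
def op (m₁ m₂ : ℕ) (u : ℝ × ℝ → ℝ) (z : ℝ × ℝ) : ℝ :=
  -(z.2 ^ m₁) * dx (dx u) z - z.1 ^ m₂ * dy (dy u) z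

/-- The critical exponent `2*(m₁, m₂)`. -/
def critExp (m₁ m₂ : ℕ) : ℝ :=
  (2 * ((m₁ : ℝ) + m₂) + 8) / ((m₁ : ℝ) + m₂ + m₁ * m₂)

/-- The characteristic coordinate `2 / (m + 2) * t ^ ((m + 2) / 2)`, used for `t ≥ 0` only. -/
def charCoord (m : ℕ) (t : ℝ) : ℝ :=
  2 / ((m : ℝ) + 2) * t ^ (((m : ℝ) + 2) / 2)

/-- The abscissa of the vertex `C`, in which the two characteristics meet. -/
def xC (m₁ m₂ : ℕ) (y₀ : ℝ) : ℝ :=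
  (1 / 2 * (((m₂ : ℝ) + 2) / ((m₁ : ℝ) + 2)) * (-(2 * y₀)) ^ (((m₁ : ℝ) + 2) / 2))
    ^ (2 / ((m₂ : ℝ) + 2))

/-- The characteristic arc `AC` through `A = (0, 2 y₀)`. -/
def arcAC (m₁ m₂ : ℕ) (y₀ : ℝ) : Set (ℝ × ℝ) :=
  {z | 0 ≤ z.1 ∧ z.1 ≤ xC m₁ m₂ y₀ ∧ z.2 ≤ 0 ∧
    charCoord m₁ (-(2 * y₀)) - charCoord m₁ (-z.2) = charCoord m₂ z.1}

/-- The characteristic arc `BC` through `B = (0, 0)`. -/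
def arcBC (m₁ m₂ : ℕ) (y₀ : ℝ) : Set (ℝ × ℝ) :=
  {z | 0 ≤ z.1 ∧ z.1 ≤ xC m₁ m₂ y₀ ∧ z.2 ≤ 0 ∧ charCoord m₁ (-z.2) = charCoord m₂ z.1}

/-- The segment `AB` on the axis `x = 0`. -/
def segAB (y₀ : ℝ) : Set (ℝ × ℝ) :=
  {z | z.1 = 0 ∧ 2 * y₀ ≤ z.2 ∧ z.2 ≤ 0}

/-- The characteristic triangle: the open region enclosed by the segment `AB` and the
characteristic arcs `AC`, `BC`. -/
def triangle (m₁ m₂ : ℕ) (y₀ : ℝ) : Set (ℝ × ℝ) :=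
  {z | 0 < z.1 ∧ z.2 < 0 ∧ charCoord m₂ z.1 < charCoord m₁ (-z.2) ∧
    charCoord m₂ z.1 < charCoord m₁ (-(2 * y₀)) - charCoord m₁ (-z.2)}

theorem charCoord_zero (m : ℕ) : charCoord m 0 = 0 := by
  unfold charCoord
  rw [Real.zero_rpow (by positivity)]
  simp

theorem continuous_charCoord (m : ℕ) : Continuous (charCoord m) := by
  unfold charCoord
  exact continuous_const.mul (Real.continuous_rpow_const (by positivity))

theorem strictMonoOn_charCoord (m : ℕ) : StrictMonoOn (charCoord m) (Set.Ici 0) := by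
  intro a ha b _ hab
  unfold charCoord
  exact mul_lt_mul_of_pos_left (Real.rpow_lt_rpow ha hab (by positivity)) (by positivity)

/-- The inverse of `charCoord m` on `[0, ∞)`. -/
def charInv (m : ℕ) (r : ℝ) : ℝ := (((m : ℝ) + 2) / 2 * r) ^ (2 / ((m : ℝ) + 2))

theorem charInv_nonneg (m : ℕ) {r : ℝ} (hr : 0 ≤ r) : 0 ≤ charInv m r := by
  unfold charInv; positivity

theorem charCoord_charInv (m : ℕ) {r : ℝ} (hr : 0 ≤ r) : charCoord m (charInv m r) = r := by
  unfold charCoord charInv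
  have h : (0 : ℝ) < (m : ℝ) + 2 := by positivity
  rw [← Real.rpow_mul (by positivity)]
  have : 2 / ((m : ℝ) + 2) * (((m : ℝ) + 2) / 2) = 1 := by field_simp
  rw [this, Real.rpow_one]
  field_simp

theorem charInv_charCoord (m : ℕ) {t : ℝ} (ht : 0 ≤ t) : charInv m (charCoord m t) = t := by
  have h0 : 0 ≤ charCoord m t := by unfold charCoord; positivity
  exact (strictMonoOn_charCoord m).injOn (charInv_nonneg m h0) ht (charCoord_charInv m h0)

theorem continuous_charInv (m : ℕ) : Continuous (charInv m) := by
  unfold charInv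
  exact (Real.continuous_rpow_const (by positivity)).comp (continuous_const.mul continuous_id)

theorem charCoord_pos (m : ℕ) {t : ℝ} (ht : 0 < t) : 0 < charCoord m t := by
  unfold charCoord; positivity

theorem charInv_pos (m : ℕ) {t : ℝ} (ht : 0 < t) : 0 < charInv m t := by
  unfold charInv; positivity

theorem xC_eq (m₁ m₂ : ℕ) (y₀ : ℝ) :
    xC m₁ m₂ y₀ = charInv m₂ (charCoord m₁ (-(2 * y₀)) / 2) := by
  unfold xC charInv charCoord
  congr 1
  have h : (0 : ℝ) < (m₁ : ℝ) + 2 := by positivity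
  field_simp

theorem le_xC_iff (m₁ m₂ : ℕ) {y₀ : ℝ} (hy₀ : y₀ < 0) {x : ℝ} (hx : 0 ≤ x) :
    x ≤ xC m₁ m₂ y₀ ↔ charCoord m₂ x ≤ charCoord m₁ (-(2 * y₀)) / 2 := by
  have hS := charCoord_pos m₁ (t := -(2 * y₀)) (by linarith)
  rw [xC_eq, ← (strictMonoOn_charCoord m₂).le_iff_le hx (charInv_nonneg m₂ (by linarith)),
    charCoord_charInv m₂ (by linarith)]

theorem isOpen_triangle (m₁ m₂ : ℕ) (y₀ : ℝ) : IsOpen (triangle m₁ m₂ y₀) := by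
  have h1 : Continuous fun z : ℝ × ℝ => charCoord m₂ z.1 :=
    (continuous_charCoord m₂).comp continuous_fst
  have h2 : Continuous fun z : ℝ × ℝ => charCoord m₁ (-z.2) :=
    (continuous_charCoord m₁).comp continuous_snd.neg
  exact (isOpen_lt continuous_const continuous_fst).inter
    ((isOpen_lt continuous_snd continuous_const).inter
      ((isOpen_lt h1 h2).inter (isOpen_lt h1 (continuous_const.sub h2))))

theorem closure_triangle (m₁ m₂ : ℕ) {y₀ : ℝ} (hy₀ : y₀ < 0) :
    closure (triangle m₁ m₂ y₀) =
      {z | 0 ≤ z.1 ∧ z.2 ≤ 0 ∧ charCoord m₂ z.1 ≤ charCoord m₁ (-z.2) ∧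
        charCoord m₂ z.1 ≤ charCoord m₁ (-(2 * y₀)) - charCoord m₁ (-z.2)} := by
  have h1 : Continuous fun z : ℝ × ℝ => charCoord m₂ z.1 :=
    (continuous_charCoord m₂).comp continuous_fst
  have h2 : Continuous fun z : ℝ × ℝ => charCoord m₁ (-z.2) :=
    (continuous_charCoord m₁).comp continuous_snd.neg
  have hS := charCoord_pos m₁ (t := -(2 * y₀)) (by linarith)
  apply Set.Subset.antisymm
  · refine closure_minimal ?_ ((isClosed_le continuous_const continuous_fst).inter
      ((isClosed_le continuous_snd continuous_const).inter
        ((isClosed_le h1 h2).inter (isClosed_le h1 (continuous_const.sub h2)))))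
    rintro z ⟨a, b, c, d⟩
    exact ⟨a.le, b.le, c.le, d.le⟩
  · rintro ⟨x, y⟩ ⟨a, b, c, d⟩
    simp only at a b c d
    set S := charCoord m₁ (-(2 * y₀)) with hSdef
    set r := charCoord m₂ x with hr
    set s := charCoord m₁ (-y) with hs
    have hr0 : 0 ≤ r := by rw [hr]; unfold charCoord; positivity
    let γ : ℝ → ℝ × ℝ := fun e =>
      (charInv m₂ ((1 - e) * r + e * (S / 4)), -charInv m₁ ((1 - e) * s + e * (S / 2)))
    have hγ : Continuous γ := by
      refine Continuous.prodMk ((continuous_charInv m₂).comp ?_)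
        ((continuous_charInv m₁).comp ?_).neg <;> fun_prop
    have hγ0 : γ 0 = (x, y) := by
      simp [γ, hr, hs, charInv_charCoord m₂ a, charInv_charCoord m₁ (t := -y) (by linarith)]
    have hmaps : Set.MapsTo γ (Set.Ioc 0 1) (triangle m₁ m₂ y₀) := by
      rintro e ⟨he, he1⟩
      have e1 : 0 < (1 - e) * r + e * (S / 4) := by nlinarith
      have e2 : 0 < (1 - e) * s + e * (S / 2) := by nlinarith
      refine ⟨charInv_pos _ e1, ?_, ?_, ?_⟩
      · exact neg_lt_zero.2 (charInv_pos _ e2)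
      · simp only [γ, neg_neg]
        rw [charCoord_charInv _ e1.le, charCoord_charInv _ e2.le]
        nlinarith
      · simp only [γ, neg_neg]
        rw [charCoord_charInv _ e1.le, charCoord_charInv _ e2.le, ← hSdef]
        nlinarith
    have h0 : (0 : ℝ) ∈ closure (Set.Ioc (0 : ℝ) 1) := by
      rw [closure_Ioc (by norm_num)]; simp
    have := map_mem_closure hγ h0 hmaps
    rwa [hγ0] at this

theorem frontier_triangle (m₁ m₂ : ℕ) {y₀ : ℝ} (hy₀ : y₀ < 0) :
    frontier (triangle m₁ m₂ y₀) = segAB y₀ ∪ arcAC m₁ m₂ y₀ ∪ arcBC m₁ m₂ y₀ := by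
  have hS := charCoord_pos m₁ (t := -(2 * y₀)) (by linarith)
  rw [frontier, (isOpen_triangle m₁ m₂ y₀).interior_eq, closure_triangle m₁ m₂ hy₀]
  ext ⟨x, y⟩
  simp only [triangle, segAB, arcAC, arcBC, Set.mem_sdiff, Set.mem_ofPred_eq, Set.mem_union]
  constructor
  · rintro ⟨⟨a, b, c, d⟩, h⟩
    rw [le_xC_iff m₁ m₂ hy₀ a]
    have key : y = 0 → x = 0 := by
      rintro rfl
      rw [neg_zero, charCoord_zero] at c
      by_contra hx
      exact absurd (charCoord_pos m₂ (lt_of_le_of_ne a (Ne.symm hx))) (not_lt.2 c)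
    by_cases hx : x = 0
    · subst hx
      refine Or.inl (Or.inl ⟨rfl, ?_, b⟩)
      rw [charCoord_zero] at d
      have := ((strictMonoOn_charCoord m₁).le_iff_le
        (a := -y) (b := -(2 * y₀)) (by simpa using b) (by simp; linarith)).1 (by linarith)
      linarith
    · have hx' : 0 < x := lt_of_le_of_ne a (Ne.symm hx)
      have hy' : y < 0 := lt_of_le_of_ne b fun h => hx (key h)
      by_cases h3 : charCoord m₂ x < charCoord m₁ (-y)
      · have h4 : ¬ charCoord m₂ x < charCoord m₁ (-(2 * y₀)) - charCoord m₁ (-y) :=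
          fun h4 => h ⟨hx', hy', h3, h4⟩
        rw [not_lt] at h4
        exact Or.inl (Or.inr ⟨a, by linarith, b, by linarith⟩)
      · rw [not_lt] at h3
        exact Or.inr ⟨a, by linarith, b, by linarith⟩
  · rintro ((⟨rfl, h1, h2⟩ | ⟨a, h1, h2, h3⟩) | ⟨a, h1, h2, h3⟩)
    · have e1 := (strictMonoOn_charCoord m₁).monotoneOn (a := -y) (b := -(2 * y₀))
        (by simpa using h2) (by simp; linarith) (by linarith)
      have e2 := (strictMonoOn_charCoord m₁).monotoneOn (a := 0) (b := -y)
        (by simp) (by simpa using h2) (by linarith)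
      rw [charCoord_zero] at *
      exact ⟨⟨le_rfl, h2, e2, by linarith⟩, fun h => lt_irrefl _ h.1⟩
    · rw [le_xC_iff m₁ m₂ hy₀ a] at h1
      exact ⟨⟨a, h2, by linarith, by linarith⟩, fun h => by linarith [h.2.2.2]⟩
    · rw [le_xC_iff m₁ m₂ hy₀ a] at h1
      exact ⟨⟨a, h2, by linarith, by linarith⟩, fun h => by linarith [h.2.2.1]⟩

/-- The flow at time `t` of the vector field `D = - a x ∂_x - b y ∂_y`. -/
def flow (a b t : ℝ) (z : ℝ × ℝ) : ℝ × ℝ :=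
  (z.1 * Real.exp (-(a * t)), z.2 * Real.exp (-(b * t)))

/-- `Ω` is star-shaped with respect to `D = - a x ∂_x - b y ∂_y`: the closure of `Ω` contains, with
each of its points, the forward orbit of the point and its limit at time `+∞`, the origin. -/
def DStarShaped (a b : ℝ) (Ω : Set (ℝ × ℝ)) : Prop :=
  ∀ z ∈ closure Ω, (∀ t : ℝ, 0 ≤ t → flow a b t z ∈ closure Ω) ∧ (0, 0) ∈ closure Ω

/-- `u ∈ C²(closure Ω)`: `u` is `C²` in the open set `Ω`, and `u` and its derivatives of first and
second order extend continuously to `closure Ω` (the extension of `u` being `u` itself). -/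
structure C2UpToBoundary (Ω : Set (ℝ × ℝ)) (u : ℝ × ℝ → ℝ) : Prop where
  contDiffOn : ContDiffOn ℝ 2 u Ω
  continuousOn : ContinuousOn u (closure Ω)
  ext_fderiv : ∃ g : ℝ × ℝ → (ℝ × ℝ →L[ℝ] ℝ),
    ContinuousOn g (closure Ω) ∧ Set.EqOn g (fderiv ℝ u) Ω
  ext_fderiv_fderiv : ∃ h : ℝ × ℝ → (ℝ × ℝ →L[ℝ] (ℝ × ℝ →L[ℝ] ℝ)),
    ContinuousOn h (closure Ω) ∧ Set.EqOn h (fderiv ℝ (fderiv ℝ u)) Ω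

/-- `u` is a regular solution on `Ω` of `op u = u |u| ^ (α - 1)` with `u = 0` on `Γ`. -/
structure IsRegularSolution (m₁ m₂ : ℕ) (α : ℝ) (Ω Γ : Set (ℝ × ℝ)) (u : ℝ × ℝ → ℝ) : Prop where
  regular : C2UpToBoundary Ω u
  eqn : ∀ z ∈ Ω, op m₁ m₂ u z = u z * |u z| ^ (α - 1)
  boundary : ∀ z ∈ Γ, u z = 0

end

end Tricomi

/-!
The proof is an energy argument in which `-y` runs backwards. On the triangle `k = -y ^ m₁` is
positive, and multiplying the equation by `u_y` gives
`∂_x (k u_x u_y) - ∂_y e = (m₁ / 2) y ^ (m₁ - 1) u_x ^ 2 ≥ 0`, where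
`e = (k u_x ^ 2 + x ^ m₂ u_y ^ 2) / 2 + F(u)` is the energy density and `F` is the potential
`|t| ^ (α + 1) / (α + 1)` of the nonlinearity (`dx_fluxX_sub_dy_energy`). So the energy field
`(k u_x u_y, -e)` has nonnegative divergence. Its flux through a characteristic is a square plus a
positive multiple of `F(u)` (`char_flux_eq`, `le_char_flux`). There is no flux through `AB`, where
`u_y = 0`, nor through `AC`, where `u` and its tangential derivative vanish (`trace_segAB`,
`trace_arcAC`). Hence no flux is left to pass through the characteristics parallel to `BC`,
which forces `F(u) = 0`.

The divergence theorem is applied to the energy field times a compactly supported `C¹` cutoff, so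
that no integral over the boundary occurs. The gradient of the cutoff is of size `1 / ε` in strips
along `AB` and `AC` which have area `O(ε)` (`volume_strip_AB_le`, `volume_strip_AC_le`) and in which
the flux is uniformly small (`exists_flux_lt`); elsewhere the gradient has the favourable
direction (`cutoff_flux_ge`).

The argument works for all `α > -1`, and the critical exponent is nonnegative. For `α ≤ 0` the
potential is not differentiable at `0`, but the composite `F(u)` still is `C¹`: as the left-hand
side of the equation is continuous, `u` vanishes near each of its zeros
(`hasFDerivAt_potential_comp`).
-/

namespace Tricomi

open Set Filter Topology MeasureTheory

/-! ### Analytic preliminaries -/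

/-- On a compact set, a continuous function that vanishes on the zero set of a nonnegative
continuous function `H` is uniformly small where `H` is small. -/
theorem exists_pos_forall_abs_lt {X : Type*} [TopologicalSpace X] {K : Set X} (hK : IsCompact K)
    {G H : X → ℝ} (hG : ContinuousOn G K) (hH : ContinuousOn H K) (hH0 : ∀ z ∈ K, 0 ≤ H z)
    (h : ∀ z ∈ K, H z = 0 → G z = 0) {σ : ℝ} (hσ : 0 < σ) :
    ∃ δ > 0, ∀ z ∈ K, H z < δ → |G z| < σ := by
  have hK' : IsCompact (K ∩ (fun z => |G z|) ⁻¹' Ici σ) := by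
    obtain ⟨v, hv, hv'⟩ := continuousOn_iff_isClosed.1 hG.abs (Ici σ) isClosed_Ici
    rw [inter_comm, hv', inter_comm]
    exact hK.inter_right hv
  rcases (K ∩ (fun z => |G z|) ⁻¹' Ici σ).eq_empty_or_nonempty with he | hne
  · refine ⟨1, one_pos, fun z hz _ => ?_⟩
    by_contra hcon
    exact (he ▸ (⟨hz, not_lt.1 hcon⟩ : z ∈ K ∩ (fun z => |G z|) ⁻¹' Ici σ) : z ∈ (∅ : Set X))
  · obtain ⟨z₀, hz₀, hmin⟩ := hK'.exists_isMinOn hne (hH.mono inter_subset_left)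
    refine ⟨H z₀, lt_of_le_of_ne (hH0 _ hz₀.1) fun h0 => ?_, fun z hz hlt => ?_⟩
    · have h1 : σ ≤ |G z₀| := hz₀.2
      rw [h z₀ hz₀.1 h0.symm, abs_zero] at h1
      linarith
    · by_contra hcon
      exact absurd (hmin ⟨hz, not_lt.1 hcon⟩) (not_le.2 hlt)

/-- If the curves `w e` tend to zero pointwise as `e → 0+` and their derivatives converge at `t`,
then the limit of the derivatives is zero. -/
theorem limit_deriv_eq_zero {w h : ℝ → ℝ → ℝ} {a b t c : ℝ} (ht : t ∈ Ioo a b)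
    (hw : ∀ t ∈ Ioo a b, Tendsto (fun e => w e t) (𝓝[>] 0) (𝓝 0))
    (hd : ∀ᶠ e in 𝓝[>] (0 : ℝ), ∀ t ∈ Ioo a b, HasDerivAt (w e) (h e t) t)
    (hh : Tendsto (fun p : ℝ × ℝ => h p.1 p.2) (𝓝[>] 0 ×ˢ 𝓝 t) (𝓝 c)) : c = 0 := by
  refine abs_nonpos_iff.1 (le_of_forall_pos_le_add fun ε hε => ?_)
  rw [zero_add]
  obtain ⟨pe, hpe, pt, hpt, hp⟩ := eventually_prod_iff.1 (hh (Metric.ball_mem_nhds c hε))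
  obtain ⟨δ, hδ, hball⟩ := Metric.eventually_nhds_iff_ball.1 (hpt.and (Ioo_mem_nhds ht.1 ht.2))
  have hsub : ∀ τ ∈ Icc t (t + δ / 2), pt τ ∧ τ ∈ Ioo a b := fun τ hτ => hball τ (by
    rw [Metric.mem_ball, Real.dist_eq, abs_lt]
    constructor <;> linarith [hτ.1, hτ.2])
  have hbd : ∀ᶠ e in 𝓝[>] (0 : ℝ),
      |(w e (t + δ / 2) - c * (t + δ / 2)) - (w e t - c * t)| ≤ ε * |t + δ / 2 - t| := by
    filter_upwards [hpe, hd] with e he hde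
    refine Convex.norm_image_sub_le_of_norm_hasDerivWithin_le (s := Icc t (t + δ / 2))
      (f := fun τ => w e τ - c * τ) (f' := fun τ => h e τ - c) (fun τ hτ => ?_) (fun τ hτ => ?_)
      (convex_Icc _ _) ⟨le_rfl, by linarith⟩ ⟨by linarith, le_rfl⟩
    · have := (hde τ (hsub τ hτ).2).sub ((hasDerivAt_id τ).const_mul c)
      rw [mul_one] at this
      exact this.hasDerivWithinAt
    · have : dist (h e τ) c < ε := hp he (hsub τ hτ).1
      exact (Real.dist_eq (h e τ) c ▸ this).le
  have hlim := le_of_tendsto ((((hw _ (hsub (t + δ / 2) ⟨by linarith, le_rfl⟩).2).sub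
    (tendsto_const_nhds (x := c * (t + δ / 2)))).sub
    ((hw t ht).sub (tendsto_const_nhds (x := c * t)))).abs) hbd
  have e1 : |0 - c * (t + δ / 2) - (0 - c * t)| = |c| * (δ / 2) := by
    rw [show 0 - c * (t + δ / 2) - (0 - c * t) = -(c * (δ / 2)) by ring, abs_neg, abs_mul,
      abs_of_pos (half_pos hδ)]
  rw [e1, show t + δ / 2 - t = δ / 2 by ring, abs_of_pos (half_pos hδ)] at hlim
  exact le_of_mul_le_mul_right hlim (half_pos hδ)

/-- A `C¹` function on an open set that vanishes off a closed subset extends by zero to a `C¹`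
function. -/
theorem contDiff_indicator {E : Type*} [NormedAddCommGroup E] [NormedSpace ℝ E] {Ω K : Set E}
    (hΩ : IsOpen Ω) (hK : IsClosed K) (hKΩ : K ⊆ Ω) {h : E → ℝ} (hh : ContDiffOn ℝ 1 h Ω)
    (h0 : ∀ z ∈ Ω, z ∉ K → h z = 0) : ContDiff ℝ 1 (Ω.indicator h) := by
  rw [contDiff_iff_contDiffAt]
  intro z
  by_cases hz : z ∈ Ω
  · refine (hh.contDiffAt (hΩ.mem_nhds hz)).congr_of_eventuallyEq ?_
    filter_upwards [hΩ.mem_nhds hz] with w hw using indicator_of_mem hw h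
  · refine (contDiffAt_const (c := (0 : ℝ))).congr_of_eventuallyEq ?_
    filter_upwards [hK.isOpen_compl.mem_nhds fun hzK => hz (hKΩ hzK)] with w hw
    by_cases hwΩ : w ∈ Ω
    · rw [indicator_of_mem hwΩ, h0 w hwΩ hw]
    · rw [indicator_of_notMem hwΩ]

theorem integral_fderiv_apply_eq_zero {H : ℝ × ℝ → ℝ} (hH : ContDiff ℝ 1 H)
    (hc : HasCompactSupport H) (v : ℝ × ℝ) :
    Integrable (fun z => fderiv ℝ H z v) ∧ ∫ z, fderiv ℝ H z v = 0 := by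
  have hcont : Continuous fun z => fderiv ℝ H z v :=
    (hH.continuous_fderiv one_ne_zero).clm_apply continuous_const
  have hint : Integrable fun z => fderiv ℝ H z v :=
    hcont.integrable_of_hasCompactSupport (hc.fderiv_apply ℝ v)
  refine ⟨hint, ?_⟩
  have := integral_mul_fderiv_eq_neg_fderiv_mul_of_integrable (𝕜 := ℝ) (μ := volume)
    (f := fun _ : ℝ × ℝ => (1 : ℝ)) (g := H) (v := v) (by simp) (by simpa using hint)
    (by simpa using hH.continuous.integrable_of_hasCompactSupport hc) (by fun_prop)
    (fun z _ => hH.differentiable one_ne_zero z)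
  simpa using this

theorem hasDerivAt_sq_max (t : ℝ) : HasDerivAt (fun t : ℝ => max t 0 ^ 2) (2 * max t 0) t := by
  rcases lt_trichotomy t 0 with h | rfl | h
  · rw [max_eq_right h.le, mul_zero]
    refine (hasDerivAt_const t (0 : ℝ)).congr_of_eventuallyEq ?_
    filter_upwards [Iio_mem_nhds h] with s hs
    rw [max_eq_right (mem_Iio.1 hs).le, zero_pow two_ne_zero]
  · rw [max_self, mul_zero, hasDerivAt_iff_isLittleO_nhds_zero]
    have : (fun h : ℝ => h * h) =o[𝓝 0] fun h : ℝ => h := by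
      simpa using (Asymptotics.isLittleO_one_iff ℝ |>.2 (tendsto_id (x := 𝓝 (0 : ℝ)))).mul_isBigO
        (Asymptotics.isBigO_refl (fun h : ℝ => h) (𝓝 0))
    refine (Asymptotics.IsBigO.of_norm_le fun h => ?_).trans_isLittleO this
    rcases le_total h 0 with hh | hh
    · simpa [hh] using mul_self_nonneg h
    · simp [hh, sq]
  · rw [max_eq_left h.le]
    have h2 : HasDerivAt (fun t : ℝ => t ^ 2) (2 * t) t := by simpa using hasDerivAt_pow 2 t
    refine h2.congr_of_eventuallyEq ?_
    filter_upwards [Ioi_mem_nhds h] with s hs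
    rw [max_eq_left (mem_Ioi.1 hs).le]

theorem contDiff_sq_max : ContDiff ℝ 1 fun t : ℝ => max t 0 ^ 2 := by
  rw [contDiff_one_iff_deriv]
  refine ⟨fun t => (hasDerivAt_sq_max t).differentiableAt, ?_⟩
  rw [funext fun t => (hasDerivAt_sq_max t).deriv]
  fun_prop

/-- The `C¹` step function that is `0` for `t ≤ 0` and `1 / 2` for `t ≥ 1`, with the tent function
`stepDeriv` as its derivative. -/
noncomputable def step (t : ℝ) : ℝ :=
  max t 0 ^ 2 - 2 * max (t - 1 / 2) 0 ^ 2 + max (t - 1) 0 ^ 2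

/-- The derivative of `step`: the tent over `[0, 1]` with height `1`. -/
noncomputable def stepDeriv (t : ℝ) : ℝ :=
  2 * max t 0 - 4 * max (t - 1 / 2) 0 + 2 * max (t - 1) 0

theorem hasDerivAt_step (t : ℝ) : HasDerivAt step (stepDeriv t) t := by
  have h1 := (hasDerivAt_sq_max (t - 1 / 2)).comp_sub_const t (1 / 2)
  have h2 := (hasDerivAt_sq_max (t - 1)).comp_sub_const t 1
  refine (((hasDerivAt_sq_max t).sub (h1.const_mul 2)).add h2).congr_deriv ?_
  unfold stepDeriv
  ring

theorem contDiff_step : ContDiff ℝ 1 step := by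
  have h := contDiff_sq_max
  exact (h.sub ((h.comp (contDiff_id.sub contDiff_const)).const_smul (2 : ℝ))).add
    (h.comp (contDiff_id.sub contDiff_const))

theorem step_of_nonpos {t : ℝ} (ht : t ≤ 0) : step t = 0 := by
  unfold step
  rw [max_eq_right ht, max_eq_right (by linarith), max_eq_right (by linarith)]
  ring

theorem step_of_one_le {t : ℝ} (ht : 1 ≤ t) : step t = 1 / 2 := by
  unfold step
  rw [max_eq_left (by linarith), max_eq_left (by linarith), max_eq_left (by linarith)]
  ring

theorem stepDeriv_of_one_le {t : ℝ} (ht : 1 ≤ t) : stepDeriv t = 0 := by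
  unfold stepDeriv
  rw [max_eq_left (by linarith), max_eq_left (by linarith), max_eq_left (by linarith)]
  ring

theorem stepDeriv_mem_Icc (t : ℝ) : stepDeriv t ∈ Icc (0 : ℝ) 1 := by
  unfold stepDeriv
  rw [mem_Icc]
  rcases max_cases t 0 with h | h <;> rcases max_cases (t - 1 / 2) 0 with h' | h' <;>
    rcases max_cases (t - 1) 0 with h'' | h'' <;> constructor <;> linarith

theorem step_mem_Icc (t : ℝ) : step t ∈ Icc (0 : ℝ) (1 / 2) := by
  have hmono : Monotone step := monotone_of_deriv_nonneg
    (fun t => (hasDerivAt_step t).differentiableAt)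
    (fun t => (hasDerivAt_step t).deriv ▸ (stepDeriv_mem_Icc t).1)
  constructor
  · rcases le_total t 0 with h | h
    · rw [step_of_nonpos h]
    · exact (step_of_nonpos le_rfl).symm.le.trans (hmono h)
  · rcases le_total t 1 with h | h
    · exact (hmono h).trans (step_of_one_le le_rfl).le
    · rw [step_of_one_le h]

/-! ### Characteristic coordinates -/

theorem hasDerivAt_charCoord (m : ℕ) (t : ℝ) :
    HasDerivAt (charCoord m) (t ^ ((m : ℝ) / 2)) t := by
  have hm : (0 : ℝ) ≤ m := m.cast_nonneg
  have h := (Real.hasDerivAt_rpow_const (x := t) (p := ((m : ℝ) + 2) / 2)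
    (Or.inr (by linarith))).const_mul (2 / ((m : ℝ) + 2))
  refine h.congr_deriv ?_
  rw [show ((m : ℝ) + 2) / 2 - 1 = m / 2 by ring]
  field_simp

theorem contDiff_charCoord (m : ℕ) : ContDiff ℝ 1 (charCoord m) := by
  have hm : (0 : ℝ) ≤ m := m.cast_nonneg
  exact contDiff_const.mul (Real.contDiff_rpow_const_of_le (by push_cast; linarith))

theorem continuous_rpow_half (m : ℕ) : Continuous fun t : ℝ => t ^ ((m : ℝ) / 2) :=
  Real.continuous_rpow_const (by positivity)

theorem rpow_half_sq (m : ℕ) {t : ℝ} (ht : 0 ≤ t) : (t ^ ((m : ℝ) / 2)) ^ 2 = t ^ m := by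
  rw [← Real.rpow_natCast, ← Real.rpow_mul ht, ← Real.rpow_natCast t m]
  congr 1
  push_cast
  ring

theorem charCoord_nonneg (m : ℕ) {t : ℝ} (ht : 0 ≤ t) : 0 ≤ charCoord m t := by
  unfold charCoord
  positivity

theorem charCoord_le_iff (m : ℕ) {s t : ℝ} (hs : 0 ≤ s) (ht : 0 ≤ t) :
    charCoord m s ≤ charCoord m t ↔ s ≤ t :=
  (strictMonoOn_charCoord m).le_iff_le hs ht

/-- The derivative of `charInv m`, the reciprocal of that of `charCoord m`. -/
noncomputable def charInvDeriv (m : ℕ) (r : ℝ) : ℝ := (charInv m r ^ ((m : ℝ) / 2))⁻¹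

theorem charInvDeriv_pos (m : ℕ) {r : ℝ} (hr : 0 < r) : 0 < charInvDeriv m r :=
  inv_pos.2 (Real.rpow_pos_of_pos (charInv_pos m hr) _)

theorem hasDerivAt_charInv (m : ℕ) {r : ℝ} (hr : 0 < r) :
    HasDerivAt (charInv m) (charInvDeriv m r) r := by
  refine HasDerivAt.of_local_left_inverse (continuous_charInv m).continuousAt
    (hasDerivAt_charCoord m _) (Real.rpow_pos_of_pos (charInv_pos m hr) _).ne' ?_
  filter_upwards [Ioi_mem_nhds hr] with y hy using charCoord_charInv m (mem_Ioi.1 hy).le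

theorem continuousAt_charInvDeriv (m : ℕ) {r : ℝ} (hr : 0 < r) :
    ContinuousAt (charInvDeriv m) r :=
  ((continuous_rpow_half m).comp (continuous_charInv m)).continuousAt.inv₀
    (Real.rpow_pos_of_pos (charInv_pos m hr) _).ne'

/-- The point of the fourth quadrant with characteristic coordinates `(r, s)`. -/
noncomputable def charPoint (m₁ m₂ : ℕ) (r s : ℝ) : ℝ × ℝ := (charInv m₂ r, -charInv m₁ s)

theorem continuous_charPoint (m₁ m₂ : ℕ) :
    Continuous fun p : ℝ × ℝ => charPoint m₁ m₂ p.1 p.2 :=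
  ((continuous_charInv m₂).comp continuous_fst).prodMk ((continuous_charInv m₁).comp
    continuous_snd).neg

theorem charPoint_charCoord (m₁ m₂ : ℕ) {z : ℝ × ℝ} (h1 : 0 ≤ z.1) (h2 : z.2 ≤ 0) :
    charPoint m₁ m₂ (charCoord m₂ z.1) (charCoord m₁ (-z.2)) = z := by
  unfold charPoint
  rw [charInv_charCoord _ h1, charInv_charCoord _ (by linarith), neg_neg]

theorem charPoint_mem_closure (m₁ m₂ : ℕ) {y₀ : ℝ} (hy₀ : y₀ < 0) {r s : ℝ} (hr : 0 ≤ r)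
    (hrs : r ≤ s) (hs : s ≤ charCoord m₁ (-(2 * y₀)) - r) :
    charPoint m₁ m₂ r s ∈ closure (triangle m₁ m₂ y₀) := by
  rw [closure_triangle m₁ m₂ hy₀]
  refine ⟨charInv_nonneg _ hr, neg_nonpos.2 (charInv_nonneg _ (hr.trans hrs)), ?_, ?_⟩ <;>
  · simp only [charPoint, neg_neg]
    rw [charCoord_charInv _ hr, charCoord_charInv _ (hr.trans hrs)]
    linarith

theorem charPoint_mem_triangle (m₁ m₂ : ℕ) {y₀ : ℝ} {r s : ℝ} (hr : 0 < r)
    (hrs : r < s) (hs : s < charCoord m₁ (-(2 * y₀)) - r) :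
    charPoint m₁ m₂ r s ∈ triangle m₁ m₂ y₀ := by
  refine ⟨charInv_pos _ hr, neg_neg_of_pos (charInv_pos _ (hr.trans hrs)), ?_, ?_⟩ <;>
  · simp only [charPoint, neg_neg]
    rw [charCoord_charInv _ hr.le, charCoord_charInv _ (hr.trans hrs).le]
    linarith

theorem isCompact_closure_triangle (m₁ m₂ : ℕ) {y₀ : ℝ} (hy₀ : y₀ < 0) :
    IsCompact (closure (triangle m₁ m₂ y₀)) := by
  refine (isCompact_Icc (a := ((0 : ℝ), 2 * y₀))
    (b := (charInv m₂ (charCoord m₁ (-(2 * y₀))), (0 : ℝ)))).of_isClosed_subset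
    isClosed_closure fun z hz => ?_
  rw [closure_triangle m₁ m₂ hy₀] at hz
  obtain ⟨h1, h2, h3, h4⟩ := hz
  have hR := charCoord_nonneg m₂ h1
  have hS := charCoord_nonneg m₁ (t := -z.2) (by linarith)
  have hS0 := charCoord_nonneg m₁ (t := -(2 * y₀)) (by linarith)
  refine ⟨⟨h1, ?_⟩, ⟨?_, h2⟩⟩
  · have := (charCoord_le_iff m₁ (s := -z.2) (t := -(2 * y₀)) (by linarith) (by linarith)).1
      (by linarith)
    show 2 * y₀ ≤ z.2
    linarith
  · refine (charCoord_le_iff m₂ h1 (charInv_nonneg _ hS0)).1 ?_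
    rw [charCoord_charInv _ hS0]
    linarith

/-! ### Traces of the gradient on the boundary -/

/-- Let `u` vanish on a boundary curve that is affine in characteristic coordinates. Then the
continuous extension of the gradient annihilates the tangent of that curve. The curve is approached
from within the triangle by its contractions towards an interior point. -/
theorem trace_apply_tangent_eq_zero (m₁ m₂ : ℕ) {y₀ : ℝ} (hy₀ : y₀ < 0) {u : ℝ × ℝ → ℝ}
    (hud : DifferentiableOn ℝ u (triangle m₁ m₂ y₀))
    (huc : ContinuousOn u (closure (triangle m₁ m₂ y₀)))
    {g : ℝ × ℝ → (ℝ × ℝ →L[ℝ] ℝ)} (hg : ContinuousOn g (closure (triangle m₁ m₂ y₀)))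
    (hgu : EqOn g (fderiv ℝ u) (triangle m₁ m₂ y₀)) {r₀ κ s₀ l a b t : ℝ} (ht : t ∈ Ioo a b)
    (hr : ∀ t ∈ Ioo a b, 0 ≤ r₀ + κ * t) (hrs : ∀ t ∈ Ioo a b, r₀ + κ * t ≤ s₀ + l * t)
    (hs : ∀ t ∈ Ioo a b, s₀ + l * t ≤ charCoord m₁ (-(2 * y₀)) - (r₀ + κ * t))
    (hu0 : ∀ t ∈ Ioo a b, u (charPoint m₁ m₂ (r₀ + κ * t) (s₀ + l * t)) = 0)
    {d : ℝ × ℝ}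
    (hd : Tendsto (fun p : ℝ × ℝ =>
      ((1 - p.1) * κ * charInvDeriv m₂
          ((1 - p.1) * (r₀ + κ * p.2) + p.1 * (charCoord m₁ (-(2 * y₀)) / 4)),
        -((1 - p.1) * l * charInvDeriv m₁
          ((1 - p.1) * (s₀ + l * p.2) + p.1 * (charCoord m₁ (-(2 * y₀)) / 2)))))
      (𝓝[>] 0 ×ˢ 𝓝 t) (𝓝 d)) :
    g (charPoint m₁ m₂ (r₀ + κ * t) (s₀ + l * t)) d = 0 := by
  have hS := charCoord_pos m₁ (t := -(2 * y₀)) (by linarith)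
  set S := charCoord m₁ (-(2 * y₀)) with hSdef
  let ρ : ℝ → ℝ → ℝ := fun e t => (1 - e) * (r₀ + κ * t) + e * (S / 4)
  let ς : ℝ → ℝ → ℝ := fun e t => (1 - e) * (s₀ + l * t) + e * (S / 2)
  let Γ : ℝ → ℝ → ℝ × ℝ := fun e t => charPoint m₁ m₂ (ρ e t) (ς e t)
  have hΓc : Continuous fun p : ℝ × ℝ => Γ p.1 p.2 :=
    (continuous_charPoint m₁ m₂).comp (f := fun p : ℝ × ℝ => (ρ p.1 p.2, ς p.1 p.2))
      (by fun_prop)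
  have hbounds : ∀ e ∈ Ioo (0 : ℝ) 1, ∀ t ∈ Ioo a b,
      0 < ρ e t ∧ ρ e t < ς e t ∧ ς e t < S - ρ e t := by
    rintro e ⟨he0, he1⟩ t ht
    have h1 := hr t ht
    have h2 := hrs t ht
    have h3 := hs t ht
    have e1 := mul_nonneg (sub_nonneg.2 he1.le) h1
    have e2 := mul_nonneg (sub_nonneg.2 he1.le) (sub_nonneg.2 h2)
    have e3 := mul_nonneg (sub_nonneg.2 he1.le) (sub_nonneg.2 h3)
    have e4 := mul_pos he0 hS
    simp only [ρ, ς]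
    refine ⟨?_, ?_, ?_⟩ <;> nlinarith
  have hmem : ∀ e ∈ Ioo (0 : ℝ) 1, ∀ t ∈ Ioo a b, Γ e t ∈ triangle m₁ m₂ y₀ := by
    intro e he t ht
    obtain ⟨h1, h2, h3⟩ := hbounds e he t ht
    exact charPoint_mem_triangle m₁ m₂ h1 h2 h3
  have hΓ0 : ∀ t, Γ 0 t = charPoint m₁ m₂ (r₀ + κ * t) (s₀ + l * t) := fun t => by
    simp [Γ, ρ, ς]
  have hmem0 : ∀ t ∈ Ioo a b, Γ 0 t ∈ closure (triangle m₁ m₂ y₀) := fun t ht =>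
    hΓ0 t ▸ charPoint_mem_closure m₁ m₂ hy₀ (hr t ht) (hrs t ht) (hs t ht)
  have hev : ∀ᶠ e in 𝓝[>] (0 : ℝ), e ∈ Ioo (0 : ℝ) 1 := Ioo_mem_nhdsGT one_pos
  refine limit_deriv_eq_zero (w := fun e t => u (Γ e t))
    (h := fun e t => g (Γ e t) ((1 - e) * κ * charInvDeriv m₂ (ρ e t),
      -((1 - e) * l * charInvDeriv m₁ (ς e t)))) ht (fun t ht => ?_) ?_ ?_
  · have h1 : Tendsto (fun e => Γ e t) (𝓝[>] 0) (𝓝[closure (triangle m₁ m₂ y₀)] (Γ 0 t)) :=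
      tendsto_nhdsWithin_iff.2 ⟨((hΓc.comp (Continuous.prodMk_left t)).tendsto 0).mono_left
        nhdsWithin_le_nhds, hev.mono fun e he => subset_closure (hmem e he t ht)⟩
    have h2 := (huc _ (hmem0 t ht)).tendsto.comp h1
    rwa [hΓ0, hu0 t ht] at h2
  · filter_upwards [hev] with e he t ht
    obtain ⟨h1, h2, h3⟩ := hbounds e he t ht
    have hρ : HasDerivAt (ρ e) ((1 - e) * κ) t :=
      ((((hasDerivAt_id t).const_mul κ).const_add r₀).const_mul (1 - e)).add_const _
        |>.congr_deriv (by ring)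
    have hς : HasDerivAt (ς e) ((1 - e) * l) t :=
      ((((hasDerivAt_id t).const_mul l).const_add s₀).const_mul (1 - e)).add_const _
        |>.congr_deriv (by ring)
    have hΓ : HasDerivAt (Γ e) ((1 - e) * κ * charInvDeriv m₂ (ρ e t),
        -((1 - e) * l * charInvDeriv m₁ (ς e t))) t :=
      (((hasDerivAt_charInv m₂ h1).comp t hρ).congr_deriv (by ring)).prodMk
        (((hasDerivAt_charInv m₁ (h1.trans h2)).comp t hς).congr_deriv (by ring)).neg
    have hz := hmem e he t ht
    rw [hgu hz]
    exact ((hud _ hz).differentiableAt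
      ((isOpen_triangle m₁ m₂ y₀).mem_nhds hz)).hasFDerivAt.comp_hasDerivAt t hΓ
  · have hev2 : ∀ᶠ p : ℝ × ℝ in 𝓝[>] 0 ×ˢ 𝓝 t, Γ p.1 p.2 ∈ closure (triangle m₁ m₂ y₀) := by
      filter_upwards [prod_mem_prod hev (Ioo_mem_nhds ht.1 ht.2)] with p hp
      exact subset_closure (hmem _ hp.1 _ hp.2)
    have h1 : Tendsto (fun p : ℝ × ℝ => Γ p.1 p.2) (𝓝[>] 0 ×ˢ 𝓝 t)
        (𝓝[closure (triangle m₁ m₂ y₀)] (Γ 0 t)) := by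
      refine tendsto_nhdsWithin_iff.2 ⟨(hΓc.tendsto (0, t)).mono_left ?_, hev2⟩
      rw [nhds_prod_eq]
      exact prod_mono_left _ nhdsWithin_le_nhds
    have h2 := (hg _ (hmem0 t ht)).tendsto.comp h1
    rw [hΓ0] at h2
    exact (isBoundedBilinearMap_apply.continuous.tendsto (_, d)).comp (h2.prodMk_nhds hd)

theorem tendsto_prod_of_continuousAt {X : Type*} [TopologicalSpace X] {f : ℝ × ℝ → X} {t : ℝ}
    (hf : ContinuousAt f (0, t)) {c : X} (hc : f (0, t) = c) :
    Tendsto f (𝓝[>] 0 ×ˢ 𝓝 t) (𝓝 c) := by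
  rw [← hc]
  refine hf.tendsto.mono_left ?_
  rw [nhds_prod_eq]
  exact prod_mono_left _ nhdsWithin_le_nhds

/-- On the segment `AB` the derivative along the segment vanishes. -/
theorem trace_segAB (m₁ m₂ : ℕ) {y₀ : ℝ} (hy₀ : y₀ < 0) {u : ℝ × ℝ → ℝ}
    (hud : DifferentiableOn ℝ u (triangle m₁ m₂ y₀))
    (huc : ContinuousOn u (closure (triangle m₁ m₂ y₀)))
    {g : ℝ × ℝ → (ℝ × ℝ →L[ℝ] ℝ)} (hg : ContinuousOn g (closure (triangle m₁ m₂ y₀)))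
    (hgu : EqOn g (fderiv ℝ u) (triangle m₁ m₂ y₀)) (hu0 : ∀ z ∈ segAB y₀, u z = 0)
    {z : ℝ × ℝ} (hz : z ∈ closure (triangle m₁ m₂ y₀)) (hz0 : z.1 = 0) : g z (0, 1) = 0 := by
  have hS := charCoord_pos m₁ (t := -(2 * y₀)) (by linarith)
  have hint : EqOn (fun s => g (charPoint m₁ m₂ 0 s) (0, 1)) (fun _ => 0)
      (Ioo 0 (charCoord m₁ (-(2 * y₀)))) := by
    intro t ht
    have h := trace_apply_tangent_eq_zero m₁ m₂ hy₀ hud huc hg hgu (r₀ := 0) (κ := 0) (s₀ := 0)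
      (l := 1) (d := (0, -charInvDeriv m₁ t)) ht (fun t ht => by simp)
      (fun t ht => by simpa using ht.1.le) (fun t ht => by simpa using ht.2.le) (fun t ht => by
        refine hu0 _ ?_
        have h := charPoint_mem_closure m₁ m₂ hy₀ le_rfl ht.1.le (by simpa using ht.2.le)
        rw [closure_triangle m₁ m₂ hy₀] at h
        obtain ⟨-, h2, -, h4⟩ := h
        simp only [charPoint, neg_neg, zero_add, zero_mul, one_mul] at h2 h4 ⊢
        rw [charCoord_charInv _ le_rfl] at h4
        have := (charCoord_le_iff m₁ (charInv_nonneg m₁ ht.1.le)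
          (t := -(2 * y₀)) (by linarith)).1 (by linarith)
        refine ⟨?_, by simp only; linarith, h2⟩
        simp only [charInv, mul_zero]
        exact Real.zero_rpow (by positivity)) (by
      simp only [mul_zero, zero_mul, zero_add, one_mul, mul_one]
      refine tendsto_prod_of_continuousAt ?_ (by simp)
      refine continuousAt_const.prodMk (ContinuousAt.neg (ContinuousAt.mul (by fun_prop) ?_))
      refine ContinuousAt.comp (g := charInvDeriv m₁) ?_ (by fun_prop)
      simpa using continuousAt_charInvDeriv m₁ ht.1)
    rw [show ((0 : ℝ), -charInvDeriv m₁ t) = (-charInvDeriv m₁ t) • ((0 : ℝ), (1 : ℝ)) by simp,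
      map_smul, smul_eq_mul] at h
    simpa [(charInvDeriv_pos m₁ ht.1).ne'] using h
  have hall : EqOn (fun s => g (charPoint m₁ m₂ 0 s) (0, 1)) (fun _ => 0)
      (Icc 0 (charCoord m₁ (-(2 * y₀)))) := by
    refine hint.of_subset_closure ?_ continuousOn_const Ioo_subset_Icc_self
      (closure_Ioo hS.ne).ge
    refine ContinuousOn.clm_apply (hg.comp ?_ fun s hs => ?_) continuousOn_const
    · exact ((continuous_charPoint m₁ m₂).comp (Continuous.prodMk_right 0)).continuousOn
    · exact charPoint_mem_closure m₁ m₂ hy₀ le_rfl hs.1 (by simpa using hs.2)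
  rw [closure_triangle m₁ m₂ hy₀] at hz
  obtain ⟨h1, h2, h3, h4⟩ := hz
  have h := hall (x := charCoord m₁ (-z.2)) ⟨charCoord_nonneg _ (by linarith), by
    rw [hz0, charCoord_zero] at h4; linarith⟩
  have hp := charPoint_charCoord m₁ m₂ h1 h2
  rw [hz0, charCoord_zero] at hp
  simpa only [hp] using h

/-- On the arc `AC` the derivative along the arc vanishes. -/
theorem trace_arcAC (m₁ m₂ : ℕ) {y₀ : ℝ} (hy₀ : y₀ < 0) {u : ℝ × ℝ → ℝ}
    (hud : DifferentiableOn ℝ u (triangle m₁ m₂ y₀))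
    (huc : ContinuousOn u (closure (triangle m₁ m₂ y₀)))
    {g : ℝ × ℝ → (ℝ × ℝ →L[ℝ] ℝ)} (hg : ContinuousOn g (closure (triangle m₁ m₂ y₀)))
    (hgu : EqOn g (fderiv ℝ u) (triangle m₁ m₂ y₀)) (hu0 : ∀ z ∈ arcAC m₁ m₂ y₀, u z = 0)
    {z : ℝ × ℝ} (hz : z ∈ closure (triangle m₁ m₂ y₀))
    (hz0 : charCoord m₂ z.1 + charCoord m₁ (-z.2) = charCoord m₁ (-(2 * y₀))) :
    u z = 0 ∧ (-z.2) ^ ((m₁ : ℝ) / 2) * g z (1, 0) + z.1 ^ ((m₂ : ℝ) / 2) * g z (0, 1) = 0 := by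
  have hS := charCoord_pos m₁ (t := -(2 * y₀)) (by linarith)
  set S := charCoord m₁ (-(2 * y₀)) with hSdef
  have hAC : ∀ w ∈ closure (triangle m₁ m₂ y₀), charCoord m₂ w.1 + charCoord m₁ (-w.2) = S →
      u w = 0 := by
    intro w hw hw0
    rw [closure_triangle m₁ m₂ hy₀] at hw
    obtain ⟨h1, h2, h3, h4⟩ := hw
    exact hu0 w ⟨h1, (le_xC_iff m₁ m₂ hy₀ h1).2 (by rw [← hSdef]; linarith), h2,
      by rw [← hSdef]; linarith⟩
  refine ⟨hAC z hz hz0, ?_⟩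
  have hmem : ∀ r ∈ Icc 0 (S / 2), charPoint m₁ m₂ r (S - r) ∈ closure (triangle m₁ m₂ y₀) :=
    fun r hr => charPoint_mem_closure m₁ m₂ hy₀ hr.1 (by linarith [hr.2]) le_rfl
  let q : ℝ × ℝ → ℝ := fun z =>
    (-z.2) ^ ((m₁ : ℝ) / 2) * g z (1, 0) + z.1 ^ ((m₂ : ℝ) / 2) * g z (0, 1)
  have hint : EqOn (fun r => q (charPoint m₁ m₂ r (S - r))) (fun _ => 0) (Ioo 0 (S / 2)) := by
    intro t ht
    have hSt : 0 < S - t := by linarith [ht.2]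
    have h := trace_apply_tangent_eq_zero m₁ m₂ hy₀ hud huc hg hgu (r₀ := 0) (κ := 1) (s₀ := S)
      (l := -1) (d := (charInvDeriv m₂ t, charInvDeriv m₁ (S - t))) ht
      (fun t ht => by linarith [ht.1]) (fun t ht => by linarith [ht.2])
      (fun t ht => by linarith) (fun t ht => by
        rw [zero_add, one_mul, neg_one_mul, ← sub_eq_add_neg]
        refine hAC _ (hmem t ⟨ht.1.le, ht.2.le⟩) ?_
        simp only [charPoint, neg_neg]
        rw [charCoord_charInv _ ht.1.le, charCoord_charInv _ (by linarith [ht.2])]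
        ring) (by
      simp only [zero_add, one_mul, mul_one, mul_neg, neg_mul, neg_neg, ← sub_eq_add_neg]
      refine tendsto_prod_of_continuousAt ?_ (by simp)
      refine ContinuousAt.prodMk (ContinuousAt.mul (by fun_prop) ?_)
        (ContinuousAt.mul (by fun_prop) ?_)
      · refine ContinuousAt.comp (g := charInvDeriv m₂) ?_ (by fun_prop)
        simpa using continuousAt_charInvDeriv m₂ ht.1
      · refine ContinuousAt.comp (g := charInvDeriv m₁) ?_ (by fun_prop)
        simpa using continuousAt_charInvDeriv m₁ hSt)
    rw [zero_add, one_mul, neg_one_mul, ← sub_eq_add_neg] at h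
    have hp1 := Real.rpow_pos_of_pos (charInv_pos m₂ ht.1) ((m₂ : ℝ) / 2)
    have hp2 := Real.rpow_pos_of_pos (charInv_pos m₁ hSt) ((m₁ : ℝ) / 2)
    rw [show (charInvDeriv m₂ t, charInvDeriv m₁ (S - t)) =
      charInvDeriv m₂ t • ((1 : ℝ), (0 : ℝ)) + charInvDeriv m₁ (S - t) • ((0 : ℝ), (1 : ℝ)) by
        simp, map_add, map_smul, map_smul, smul_eq_mul, smul_eq_mul] at h
    unfold charInvDeriv at h
    simp only [q, charPoint, neg_neg] at h ⊢
    field_simp at h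
    linarith
  have hall : EqOn (fun r => q (charPoint m₁ m₂ r (S - r))) (fun _ => 0) (Icc 0 (S / 2)) := by
    refine hint.of_subset_closure ?_ continuousOn_const Ioo_subset_Icc_self
      (closure_Ioo (half_pos hS).ne).ge
    have hq : ContinuousOn q (closure (triangle m₁ m₂ y₀)) := by
      refine ContinuousOn.add (ContinuousOn.mul ?_ (hg.clm_apply continuousOn_const))
        (ContinuousOn.mul ?_ (hg.clm_apply continuousOn_const))
      · exact ((continuous_rpow_half m₁).comp continuous_snd.neg).continuousOn
      · exact ((continuous_rpow_half m₂).comp continuous_fst).continuousOn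
    refine hq.comp ?_ hmem
    exact ((continuous_charPoint m₁ m₂).comp
      (continuous_id.prodMk (continuous_const.sub continuous_id))).continuousOn
  have hz' := hz
  rw [closure_triangle m₁ m₂ hy₀] at hz'
  obtain ⟨h1, h2, h3, h4⟩ := hz'
  have h := hall (x := charCoord m₂ z.1) ⟨charCoord_nonneg _ h1, by linarith⟩
  have hp := charPoint_charCoord m₁ m₂ h1 h2
  rw [show charCoord m₁ (-z.2) = S - charCoord m₂ z.1 by linarith] at hp
  simpa only [hp] using h

/-! ### The nonlinearity -/

/-- The potential of the nonlinearity `t |t| ^ (α - 1)`. -/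
noncomputable def potential (α t : ℝ) : ℝ := |t| ^ (α + 1) / (α + 1)

theorem potential_nonneg {α : ℝ} (hα : -1 < α) (t : ℝ) : 0 ≤ potential α t :=
  div_nonneg (Real.rpow_nonneg (abs_nonneg t) _) (by linarith)

theorem potential_pos {α : ℝ} (hα : -1 < α) {t : ℝ} (ht : t ≠ 0) : 0 < potential α t :=
  div_pos (Real.rpow_pos_of_pos (abs_pos.2 ht) _) (by linarith)

theorem potential_zero {α : ℝ} (hα : -1 < α) : potential α 0 = 0 := by
  unfold potential
  rw [abs_zero, Real.zero_rpow (by linarith), zero_div]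

theorem continuous_potential {α : ℝ} (hα : -1 < α) : Continuous (potential α) := by
  unfold potential
  exact (continuous_abs.rpow_const fun _ => Or.inr (by linarith)).div_const _

theorem hasDerivAt_potential {α : ℝ} (hα : -1 < α) {t : ℝ} (h : t ≠ 0 ∨ 0 < α) :
    HasDerivAt (potential α) (t * |t| ^ (α - 1)) t := by
  have hα1 : α + 1 ≠ 0 := by linarith
  by_cases ht : t = 0
  · have h0 : 0 < α := h.resolve_left (not_not.2 ht)
    subst ht
    rw [zero_mul]
    have := (hasDerivAt_abs_rpow (0 : ℝ) (p := α + 1) (by linarith)).div_const (α + 1)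
    exact this.congr_deriv (by simp)
  · have h1 := ((hasDerivAt_abs ht).rpow_const (p := α + 1)
      (Or.inl (abs_ne_zero.2 ht))).div_const (α + 1)
    refine h1.congr_deriv ?_
    have h2 : |t| ^ α = |t| ^ (α - 1) * |t| := by
      rw [← Real.rpow_add_one (abs_ne_zero.2 ht), sub_add_cancel]
    rw [add_sub_cancel_right, h2]
    field_simp
    rw [sign_mul_abs]

/-- Along a solution, the potential of the nonlinearity is differentiable, with the expected
gradient. For `α ≤ 0` the potential is not differentiable at `0`, but then the nonlinearity is
bounded away from zero on punctured neighbourhoods of `0`, so that the continuity of the left-hand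
side of the equation makes `u` vanish near each of its zeros. -/
theorem hasFDerivAt_potential_comp {E : Type*} [NormedAddCommGroup E] [NormedSpace ℝ E] {α : ℝ}
    (hα : -1 < α) {u : E → ℝ} {z : E} (hu : DifferentiableAt ℝ u z)
    (hc : ContinuousAt (fun z => u z * |u z| ^ (α - 1)) z) :
    HasFDerivAt (fun z => potential α (u z)) ((u z * |u z| ^ (α - 1)) • fderiv ℝ u z) z := by
  by_cases h : u z ≠ 0 ∨ 0 < α
  · exact (hasDerivAt_potential hα h).comp_hasFDerivAt z hu.hasFDerivAt
  · push Not at h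
    obtain ⟨h0, hα0⟩ := h
    have hev : ∀ᶠ w in 𝓝 z, u w = 0 := by
      have h1 : ∀ᶠ w in 𝓝 z, |u w * |u w| ^ (α - 1)| < 1 := by
        have := hc.abs
        refine this.eventually (Iio_mem_nhds ?_)
        simp [h0]
      have h2 : ∀ᶠ w in 𝓝 z, |u w| < 1 :=
        hu.continuousAt.abs.eventually (Iio_mem_nhds (by simp [h0]))
      filter_upwards [h1, h2] with w hw1 hw2
      by_contra hne
      have hpos : 0 < |u w| := abs_pos.2 hne
      rw [abs_mul, abs_of_nonneg (Real.rpow_nonneg hpos.le _), mul_comm,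
        ← Real.rpow_add_one hpos.ne', sub_add_cancel] at hw1
      exact absurd (Real.one_le_rpow_of_pos_of_le_one_of_nonpos hpos hw2.le hα0) (not_le.2 hw1)
    rw [h0, zero_mul, zero_smul]
    refine (hasFDerivAt_const (0 : ℝ) z).congr_of_eventuallyEq ?_
    filter_upwards [hev] with w hw
    rw [hw, potential_zero hα]

/-! ### The energy flux -/

/-- The first component of the energy flux. -/
noncomputable def fluxX (m₁ : ℕ) (u : ℝ × ℝ → ℝ) (z : ℝ × ℝ) : ℝ :=
  -(z.2 ^ m₁) * (dx u z * dy u z)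

/-- The energy density, which is minus the second component of the energy flux. -/
noncomputable def energy (m₁ m₂ : ℕ) (α : ℝ) (u : ℝ × ℝ → ℝ) (z : ℝ × ℝ) : ℝ :=
  1 / 2 * (-(z.2 ^ m₁) * dx u z ^ 2 + z.1 ^ m₂ * dy u z ^ 2) + potential α (u z)

theorem contDiffOn_fderiv_apply {Ω : Set (ℝ × ℝ)} (hΩ : IsOpen Ω) {u : ℝ × ℝ → ℝ}
    (hu : ContDiffOn ℝ 2 u Ω) (v : ℝ × ℝ) : ContDiffOn ℝ 1 (fun z => fderiv ℝ u z v) Ω :=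
  (hu.fderiv_of_isOpen hΩ (by norm_num)).clm_apply contDiffOn_const

theorem dx_dy_comm {Ω : Set (ℝ × ℝ)} (hΩ : IsOpen Ω) {u : ℝ × ℝ → ℝ}
    (hu : ContDiffOn ℝ 2 u Ω) {z : ℝ × ℝ} (hz : z ∈ Ω) : dx (dy u) z = dy (dx u) z := by
  have hd : DifferentiableAt ℝ (fderiv ℝ u) z :=
    ((hu.fderiv_of_isOpen hΩ (m := 1) (by norm_num)).differentiableOn one_ne_zero z
      hz).differentiableAt (hΩ.mem_nhds hz)
  have h : ∀ v w : ℝ × ℝ, fderiv ℝ (fun z => fderiv ℝ u z v) z w =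
      fderiv ℝ (fderiv ℝ u) z w v := fun v w => by
    rw [fderiv_clm_apply hd (differentiableAt_const v)]
    simp
  have hs := ((hu.contDiffAt (hΩ.mem_nhds hz)).isSymmSndFDerivAt (by simp)).eq (1, 0) (0, 1)
  change fderiv ℝ (fun z => fderiv ℝ u z (0, 1)) z (1, 0) =
    fderiv ℝ (fun z => fderiv ℝ u z (1, 0)) z (0, 1)
  rw [h, h, hs]

theorem continuousOn_op {Ω : Set (ℝ × ℝ)} (hΩ : IsOpen Ω) (m₁ m₂ : ℕ) {u : ℝ × ℝ → ℝ}
    (hu : ContDiffOn ℝ 2 u Ω) : ContinuousOn (op m₁ m₂ u) Ω := by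
  have h : ∀ v : ℝ × ℝ, ContinuousOn (fun z => fderiv ℝ (fun w => fderiv ℝ u w v) z v) Ω :=
    fun v => ((contDiffOn_fderiv_apply hΩ hu v).continuousOn_fderiv_of_isOpen hΩ
      le_rfl).clm_apply continuousOn_const
  exact (((continuous_snd.pow m₁).neg.continuousOn).mul (h (1, 0))).sub
    ((continuous_fst.pow m₂).continuousOn.mul (h (0, 1)))

section Flux

variable {m₁ m₂ : ℕ} {α : ℝ} {Ω : Set (ℝ × ℝ)} {u : ℝ × ℝ → ℝ}

theorem contDiffOn_potential_comp (hα : -1 < α) (hΩ : IsOpen Ω) (hu : ContDiffOn ℝ 2 u Ω)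
    (heq : ∀ z ∈ Ω, op m₁ m₂ u z = u z * |u z| ^ (α - 1)) :
    ContDiffOn ℝ 1 (fun z => potential α (u z)) Ω ∧
      ∀ z ∈ Ω, fderiv ℝ (fun z => potential α (u z)) z = op m₁ m₂ u z • fderiv ℝ u z := by
  have hfd : ∀ z ∈ Ω, HasFDerivAt (fun z => potential α (u z))
      (op m₁ m₂ u z • fderiv ℝ u z) z := by
    intro z hz
    rw [heq z hz]
    refine hasFDerivAt_potential_comp hα
      ((hu.differentiableOn two_ne_zero z hz).differentiableAt (hΩ.mem_nhds hz)) ?_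
    exact ((continuousOn_op hΩ m₁ m₂ hu).congr fun z hz => (heq z hz).symm).continuousAt
      (hΩ.mem_nhds hz)
  refine ⟨?_, fun z hz => (hfd z hz).fderiv⟩
  rw [← zero_add (1 : WithTop ℕ∞), contDiffOn_succ_iff_fderiv_of_isOpen hΩ]
  refine ⟨fun z hz => (hfd z hz).differentiableAt.differentiableWithinAt, by simp, ?_⟩
  rw [contDiffOn_zero]
  refine ContinuousOn.congr ?_ fun z hz => (hfd z hz).fderiv
  exact (continuousOn_op hΩ m₁ m₂ hu).smul (hu.continuousOn_fderiv_of_isOpen hΩ one_le_two)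

theorem contDiffOn_fluxX (hΩ : IsOpen Ω) (hu : ContDiffOn ℝ 2 u Ω) :
    ContDiffOn ℝ 1 (fluxX m₁ u) Ω :=
  (contDiff_snd.pow m₁).neg.contDiffOn.mul ((contDiffOn_fderiv_apply hΩ hu (1, 0)).mul
    (contDiffOn_fderiv_apply hΩ hu (0, 1)))

theorem contDiffOn_energy (hα : -1 < α) (hΩ : IsOpen Ω) (hu : ContDiffOn ℝ 2 u Ω)
    (heq : ∀ z ∈ Ω, op m₁ m₂ u z = u z * |u z| ^ (α - 1)) :
    ContDiffOn ℝ 1 (energy m₁ m₂ α u) Ω :=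
  (contDiffOn_const.mul (((contDiff_snd.pow m₁).neg.contDiffOn.mul
    ((contDiffOn_fderiv_apply hΩ hu (1, 0)).pow 2)).add ((contDiff_fst.pow m₂).contDiffOn.mul
    ((contDiffOn_fderiv_apply hΩ hu (0, 1)).pow 2)))).add
    (contDiffOn_potential_comp hα hΩ hu heq).1

/-- The energy identity: multiplying the equation by `u_y` exhibits a field whose divergence is
nonnegative when `m₁` is odd. -/
theorem dx_fluxX_sub_dy_energy (hα : -1 < α) (hΩ : IsOpen Ω) (hu : ContDiffOn ℝ 2 u Ω)
    (heq : ∀ z ∈ Ω, op m₁ m₂ u z = u z * |u z| ^ (α - 1)) {z : ℝ × ℝ} (hz : z ∈ Ω) :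
    dx (fluxX m₁ u) z - dy (energy m₁ m₂ α u) z =
      1 / 2 * (m₁ * z.2 ^ (m₁ - 1)) * dx u z ^ 2 := by
  have hdiff : ∀ v : ℝ × ℝ, DifferentiableAt ℝ (fun z => fderiv ℝ u z v) z := fun v =>
    ((contDiffOn_fderiv_apply hΩ hu v).differentiableOn one_ne_zero z hz).differentiableAt
      (hΩ.mem_nhds hz)
  have hX : HasFDerivAt (dx u) (fderiv ℝ (dx u) z) z := (hdiff (1, 0)).hasFDerivAt
  have hY : HasFDerivAt (dy u) (fderiv ℝ (dy u) z) z := (hdiff (0, 1)).hasFDerivAt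
  have hF : HasFDerivAt (fun z => potential α (u z)) (op m₁ m₂ u z • fderiv ℝ u z) z := by
    rw [← (contDiffOn_potential_comp hα hΩ hu heq).2 z hz]
    exact (((contDiffOn_potential_comp hα hΩ hu heq).1.differentiableOn one_ne_zero z
      hz).differentiableAt (hΩ.mem_nhds hz)).hasFDerivAt
  have hy : HasFDerivAt (fun z : ℝ × ℝ => -(z.2 ^ m₁))
      (-((m₁ * z.2 ^ (m₁ - 1)) • ContinuousLinearMap.snd ℝ ℝ ℝ)) z :=
    ((hasDerivAt_pow m₁ z.2).comp_hasFDerivAt z hasFDerivAt_snd).neg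
  have hx : HasFDerivAt (fun z : ℝ × ℝ => z.1 ^ m₂)
      ((m₂ * z.1 ^ (m₂ - 1)) • ContinuousLinearMap.fst ℝ ℝ ℝ) z :=
    (hasDerivAt_pow m₂ z.1).comp_hasFDerivAt z hasFDerivAt_fst
  have h1 : dx (fluxX m₁ u) z = -(z.2 ^ m₁) * (dx u z * dx (dy u) z + dy u z * dx (dx u) z) := by
    have h : HasFDerivAt (fluxX m₁ u) _ z := hy.mul (hX.mul hY)
    rw [dx, h.fderiv]
    simp [dx]
    ring
  have h2 : dy (energy m₁ m₂ α u) z = 1 / 2 * (-(z.2 ^ m₁) * (2 * dx u z * dy (dx u) z)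
      - m₁ * z.2 ^ (m₁ - 1) * dx u z ^ 2 + z.1 ^ m₂ * (2 * dy u z * dy (dy u) z))
      + op m₁ m₂ u z * dy u z := by
    have h : HasFDerivAt (energy m₁ m₂ α u) _ z :=
      (((hy.mul (hX.pow 2)).add (hx.mul (hY.pow 2))).const_mul (1 / 2)).add hF
    rw [dy, h.fderiv]
    simp [dy]
    ring
  rw [h1, h2, dx_dy_comm hΩ hu hz, op]
  ring

end Flux

/-! ### Integration against a cutoff -/

/-- The divergence theorem in its simplest form: a directional derivative of a function with
compact support in an open set has integral zero. -/
theorem integral_indicator_fderiv_eq_zero {Ω K : Set (ℝ × ℝ)} (hΩ : IsOpen Ω) (hK : IsCompact K)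
    (hKΩ : K ⊆ Ω) {h : ℝ × ℝ → ℝ} (hh : ContDiffOn ℝ 1 h Ω) (h0 : ∀ z ∈ Ω, z ∉ K → h z = 0)
    (v : ℝ × ℝ) : Integrable (Ω.indicator fun z => fderiv ℝ h z v) ∧
      ∫ z, Ω.indicator (fun z => fderiv ℝ h z v) z = 0 := by
  have hoff : ∀ z ∉ K, Ω.indicator h z = 0 := fun z hz => by
    by_cases hzΩ : z ∈ Ω
    · rw [indicator_of_mem hzΩ, h0 z hzΩ hz]
    · rw [indicator_of_notMem hzΩ]
  have heq : (Ω.indicator fun z => fderiv ℝ h z v) = fun z => fderiv ℝ (Ω.indicator h) z v := by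
    funext z
    by_cases hz : z ∈ Ω
    · rw [indicator_of_mem hz]
      congr 1
      refine Filter.EventuallyEq.fderiv_eq ?_
      filter_upwards [hΩ.mem_nhds hz] with w hw using (indicator_of_mem hw h).symm
    · rw [indicator_of_notMem hz]
      have : Ω.indicator h =ᶠ[𝓝 z] fun _ => 0 := by
        filter_upwards [hK.isClosed.isOpen_compl.mem_nhds fun hzK => hz (hKΩ hzK)] with w hw
          using hoff w hw
      rw [this.fderiv_eq]
      simp
  rw [heq]
  exact integral_fderiv_apply_eq_zero (contDiff_indicator hΩ hK.isClosed hKΩ hh h0)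
    (HasCompactSupport.intro hK hoff) v

theorem le_integral_of_indicator_le {X : Type*} [MeasurableSpace X] {μ : Measure X} {D : X → ℝ}
    (hD : Integrable D μ) {B E₁ E₂ : Set X} (hB : MeasurableSet B) (hE₁ : MeasurableSet E₁)
    (hE₂ : MeasurableSet E₂) (hB' : μ B ≠ ⊤) (hE₁' : μ E₁ ≠ ⊤) (hE₂' : μ E₂ ≠ ⊤) {c M : ℝ}
    (h : ∀ z, B.indicator (fun _ => c) z - E₁.indicator (fun _ => M) z -
      E₂.indicator (fun _ => M) z ≤ D z) :
    c * μ.real B - M * (μ.real E₁ + μ.real E₂) ≤ ∫ z, D z ∂μ := by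
  have i : ∀ {s : Set X} (c : ℝ), MeasurableSet s → μ s ≠ ⊤ →
      Integrable (s.indicator fun _ => c) μ := fun c hs hs' =>
    (integrable_indicator_iff hs).2 (integrableOn_const hs')
  have := integral_mono (((i c hB hB').sub (i M hE₁ hE₁')).sub (i M hE₂ hE₂')) hD h
  rw [integral_sub' ((i c hB hB').sub (i M hE₁ hE₁')) (i M hE₂ hE₂'),
    integral_sub' (i c hB hB') (i M hE₁ hE₁'), integral_indicator_const _ hB,
    integral_indicator_const _ hE₁, integral_indicator_const _ hE₂] at this
  simp only [smul_eq_mul] at this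
  linarith

/-- The cutoff: a function of `x` vanishing near `AB`, times a function of the
characteristic coordinate that is constant on `AC`, vanishing near `AC`, times an
increasing function of the characteristic coordinate that is zero on `BC`, vanishing near `BC`.
The last factor is the only one that does not become constant as `ε → 0`. -/
noncomputable def cutoff (m₁ m₂ : ℕ) (S ε c : ℝ) (z : ℝ × ℝ) : ℝ :=
  step ((z.1 - ε) / ε) * step ((S - (charCoord m₂ z.1 + charCoord m₁ (-z.2)) - ε) / ε) *
    max (charCoord m₁ (-z.2) - charCoord m₂ z.1 - c) 0 ^ 2

section Cutoff

variable (m₁ m₂ : ℕ) (S ε c : ℝ)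

theorem contDiff_cutoff : ContDiff ℝ 1 (cutoff m₁ m₂ S ε c) := by
  have hR : ContDiff ℝ 1 fun z : ℝ × ℝ => charCoord m₂ z.1 :=
    (contDiff_charCoord m₂).comp contDiff_fst
  have hS : ContDiff ℝ 1 fun z : ℝ × ℝ => charCoord m₁ (-z.2) :=
    (contDiff_charCoord m₁).comp contDiff_snd.neg
  exact ((contDiff_step.comp ((contDiff_fst.sub contDiff_const).div_const ε)).mul
    (contDiff_step.comp (((contDiff_const.sub (hR.add hS)).sub contDiff_const).div_const ε))).mul
    (contDiff_sq_max.comp ((hS.sub hR).sub contDiff_const))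

/-- The derivative of the cutoff along the vector `(P, -e)`. -/
theorem dx_cutoff_mul_sub (z : ℝ × ℝ) (P e : ℝ) :
    dx (cutoff m₁ m₂ S ε c) z * P - dy (cutoff m₁ m₂ S ε c) z * e =
      stepDeriv ((z.1 - ε) / ε) / ε *
        step ((S - (charCoord m₂ z.1 + charCoord m₁ (-z.2)) - ε) / ε) *
        max (charCoord m₁ (-z.2) - charCoord m₂ z.1 - c) 0 ^ 2 * P -
      step ((z.1 - ε) / ε) *
        (stepDeriv ((S - (charCoord m₂ z.1 + charCoord m₁ (-z.2)) - ε) / ε) / ε) *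
        max (charCoord m₁ (-z.2) - charCoord m₂ z.1 - c) 0 ^ 2 *
        (z.1 ^ ((m₂ : ℝ) / 2) * P + (-z.2) ^ ((m₁ : ℝ) / 2) * e) +
      step ((z.1 - ε) / ε) *
        step ((S - (charCoord m₂ z.1 + charCoord m₁ (-z.2)) - ε) / ε) *
        (2 * max (charCoord m₁ (-z.2) - charCoord m₂ z.1 - c) 0) *
        (-(z.1 ^ ((m₂ : ℝ) / 2)) * P + (-z.2) ^ ((m₁ : ℝ) / 2) * e) := by
  have hR : HasFDerivAt (fun z : ℝ × ℝ => charCoord m₂ z.1)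
      (z.1 ^ ((m₂ : ℝ) / 2) • ContinuousLinearMap.fst ℝ ℝ ℝ) z :=
    (hasDerivAt_charCoord m₂ z.1).comp_hasFDerivAt z hasFDerivAt_fst
  have hneg : HasFDerivAt (fun z : ℝ × ℝ => -z.2) (-ContinuousLinearMap.snd ℝ ℝ ℝ) z :=
    hasFDerivAt_snd.neg
  have hS : HasFDerivAt (fun z : ℝ × ℝ => charCoord m₁ (-z.2))
      ((-z.2) ^ ((m₁ : ℝ) / 2) • -ContinuousLinearMap.snd ℝ ℝ ℝ) z :=
    HasDerivAt.comp_hasFDerivAt (h₂ := charCoord m₁) (f := fun z : ℝ × ℝ => -z.2) z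
      (hasDerivAt_charCoord m₁ (-z.2)) hneg
  have h1 : HasFDerivAt (fun z : ℝ × ℝ => (z.1 - ε) / ε)
      (ε⁻¹ • ContinuousLinearMap.fst ℝ ℝ ℝ) z := by
    simp only [div_eq_inv_mul _ ε]
    exact (hasFDerivAt_fst.sub_const ε).const_mul ε⁻¹
  have h2 : HasFDerivAt
      (fun z : ℝ × ℝ => (S - (charCoord m₂ z.1 + charCoord m₁ (-z.2)) - ε) / ε)
      (ε⁻¹ • -(z.1 ^ ((m₂ : ℝ) / 2) • ContinuousLinearMap.fst ℝ ℝ ℝ +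
        (-z.2) ^ ((m₁ : ℝ) / 2) • -ContinuousLinearMap.snd ℝ ℝ ℝ)) z := by
    simp only [div_eq_inv_mul _ ε]
    exact (((hR.add hS).const_sub S).sub_const ε).const_mul ε⁻¹
  have h3 := (hS.sub hR).sub_const c
  have hA := (hasDerivAt_step ((z.1 - ε) / ε)).comp_hasFDerivAt z h1
  have hB := (hasDerivAt_step
    ((S - (charCoord m₂ z.1 + charCoord m₁ (-z.2)) - ε) / ε)).comp_hasFDerivAt z h2
  have hC := (hasDerivAt_sq_max
    (charCoord m₁ (-z.2) - charCoord m₂ z.1 - c)).comp_hasFDerivAt z h3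
  have h : HasFDerivAt (cutoff m₁ m₂ S ε c) _ z := (hA.mul hB).mul hC
  rw [dx, dy, h.fderiv]
  simp
  ring

theorem cutoff_nonneg (z : ℝ × ℝ) : 0 ≤ cutoff m₁ m₂ S ε c z :=
  mul_nonneg (mul_nonneg (step_mem_Icc _).1 (step_mem_Icc _).1) (sq_nonneg _)

theorem cutoff_eq_zero {ε : ℝ} (hε : 0 < ε) {z : ℝ × ℝ}
    (h : z.1 ≤ ε ∨ S - ε ≤ charCoord m₂ z.1 + charCoord m₁ (-z.2) ∨
      charCoord m₁ (-z.2) - charCoord m₂ z.1 ≤ c) : cutoff m₁ m₂ S ε c z = 0 := by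
  unfold cutoff
  rcases h with h | h | h
  · rw [step_of_nonpos (div_nonpos_of_nonpos_of_nonneg (by linarith) hε.le)]
    ring
  · rw [step_of_nonpos (t := (S - _ - ε) / ε)
      (div_nonpos_of_nonpos_of_nonneg (by linarith) hε.le)]
    ring
  · rw [max_eq_right (by linarith)]
    ring

end Cutoff

/-- The strip of the triangle along `AC` has area `O(ε)`. -/
theorem volume_strip_AC_le (m₁ m₂ : ℕ) {y₀ : ℝ} (hy₀ : y₀ < 0) :
    ∃ C : ℝ, 0 ≤ C ∧ ∀ ε : ℝ, 0 < ε → ε ≤ charCoord m₁ (-(2 * y₀)) / 4 →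
      volume.real {z ∈ triangle m₁ m₂ y₀ |
        charCoord m₁ (-(2 * y₀)) - (charCoord m₂ z.1 + charCoord m₁ (-z.2)) ≤ 2 * ε} ≤ C * ε := by
  have hS := charCoord_pos m₁ (t := -(2 * y₀)) (by linarith)
  set S := charCoord m₁ (-(2 * y₀)) with hSdef
  set Y := charInv m₁ (S / 4) with hYdef
  have hY : 0 < Y := charInv_pos _ (by linarith)
  have hYS : charCoord m₁ Y = S / 4 := charCoord_charInv _ (by linarith)
  set k := Y ^ ((m₁ : ℝ) / 2) with hk
  have hkpos : 0 < k := Real.rpow_pos_of_pos hY _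
  have hmvt : ∀ a ∈ Ici Y, ∀ b ∈ Ici Y, a ≤ b →
      k * (b - a) ≤ charCoord m₁ b - charCoord m₁ a := by
    refine (convex_Ici Y).mul_sub_le_image_sub_of_le_deriv
      (continuous_charCoord m₁).continuousOn
      (fun t _ => (hasDerivAt_charCoord m₁ t).differentiableAt.differentiableWithinAt)
      fun t ht => ?_
    rw [(hasDerivAt_charCoord m₁ t).deriv]
    rw [interior_Ici] at ht
    exact Real.rpow_le_rpow hY.le (mem_Ioi.1 ht).le (by positivity)
  set X := charInv m₂ S with hX
  have hX0 : 0 ≤ X := charInv_nonneg _ hS.le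
  refine ⟨X * (2 / k), by positivity, fun ε hε hεS => ?_⟩
  set E := {z ∈ triangle m₁ m₂ y₀ |
    S - (charCoord m₂ z.1 + charCoord m₁ (-z.2)) ≤ 2 * ε} with hE
  have hEm : MeasurableSet E := by
    refine (isOpen_triangle m₁ m₂ y₀).measurableSet.inter (IsClosed.measurableSet ?_)
    exact isClosed_le (continuous_const.sub (((continuous_charCoord m₂).comp continuous_fst).add
      ((continuous_charCoord m₁).comp continuous_snd.neg))) continuous_const
  have hslice : ∀ x, volume (Prod.mk x ⁻¹' E) ≤
      (Icc 0 X).indicator (fun _ => ENNReal.ofReal (2 * ε / k)) x := by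
    intro x
    by_cases hx : x ∈ Icc 0 X
    · rw [indicator_of_mem hx]
      refine (Real.volume_le_diam _).trans (Metric.ediam_le_of_forall_dist_le ?_)
      have key : ∀ y ∈ Prod.mk x ⁻¹' E, ∀ y' ∈ Prod.mk x ⁻¹' E, y ≤ y' →
          y' - y ≤ 2 * ε / k := by
        rintro y ⟨⟨h1, h2, h3, h4⟩, h5⟩ y' ⟨⟨h1', h2', h3', h4'⟩, h5'⟩ hyy
        simp only [← hSdef] at h1 h2 h3 h4 h5 h1' h2' h3' h4' h5'
        have hb : Y ≤ -y' := by
          rw [← charCoord_le_iff m₁ hY.le (by linarith), hYS]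
          linarith
        have := hmvt (-y') hb (-y) (mem_Ici.2 (by linarith)) (by linarith)
        rw [le_div_iff₀ hkpos]
        linarith
      intro y hy y' hy'
      rw [Real.dist_eq, abs_le]
      rcases le_total y y' with h | h
      · have := key y hy y' hy' h
        constructor <;> linarith
      · have := key y' hy' y hy h
        constructor <;> linarith
    · rw [indicator_of_notMem hx, nonpos_iff_eq_zero]
      convert measure_empty (μ := (volume : Measure ℝ))
      refine eq_empty_of_forall_notMem fun y hy => hx ?_
      obtain ⟨⟨h1, h2, h3, h4⟩, -⟩ := hy
      simp only [← hSdef] at h1 h2 h3 h4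
      refine ⟨h1.le, (charCoord_le_iff m₂ h1.le hX0).1 ?_⟩
      rw [charCoord_charInv _ hS.le]
      linarith [charCoord_pos m₁ (t := -y) (by linarith)]
  have hvol : volume E ≤ ENNReal.ofReal (X * (2 / k) * ε) := by
    rw [Measure.volume_eq_prod, Measure.prod_apply hEm]
    refine (lintegral_mono hslice).trans ?_
    rw [lintegral_indicator_const measurableSet_Icc, Real.volume_Icc, sub_zero,
      ← ENNReal.ofReal_mul (by positivity)]
    exact ENNReal.ofReal_le_ofReal (le_of_eq (by ring))
  exact ENNReal.toReal_le_of_le_ofReal (by positivity) hvol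

/-- The strip of the triangle along `AB` has area `O(ε)`. -/
theorem volume_strip_AB_le (m₁ m₂ : ℕ) {y₀ : ℝ} (hy₀ : y₀ < 0) {ε : ℝ} (hε : 0 < ε) :
    volume.real {z ∈ triangle m₁ m₂ y₀ | z.1 ≤ 2 * ε} ≤ -(4 * y₀) * ε := by
  have hsub : {z ∈ triangle m₁ m₂ y₀ | z.1 ≤ 2 * ε} ⊆ Icc 0 (2 * ε) ×ˢ Icc (2 * y₀) 0 := by
    rintro z ⟨⟨h1, h2, h3, h4⟩, h5⟩
    refine ⟨⟨h1.le, h5⟩, ?_, h2.le⟩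
    have := (charCoord_le_iff m₁ (s := -z.2) (t := -(2 * y₀)) (by linarith) (by linarith)).1
      (by linarith [charCoord_pos m₂ h1])
    linarith
  have hvol : volume (Icc 0 (2 * ε) ×ˢ Icc (2 * y₀) 0) = ENNReal.ofReal (-(4 * y₀) * ε) := by
    rw [Measure.volume_eq_prod, Measure.prod_prod, Real.volume_Icc, Real.volume_Icc,
      ← ENNReal.ofReal_mul (by linarith)]
    congr 1
    ring
  exact ENNReal.toReal_le_of_le_ofReal (by nlinarith) ((measure_mono hsub).trans_eq hvol)

/-! ### The energy estimate -/

/-- The energy flux through a characteristic parallel to `AC` is the square of the derivative along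
the characteristic, plus the potential. -/
theorem char_flux_eq {m₁ : ℕ} (hm₁ : Odd m₁) (m₂ : ℕ) {z : ℝ × ℝ} (hx : 0 ≤ z.1) (hy : z.2 ≤ 0)
    (X Y F : ℝ) :
    z.1 ^ ((m₂ : ℝ) / 2) * (-(z.2 ^ m₁) * (X * Y)) + (-z.2) ^ ((m₁ : ℝ) / 2) *
        (1 / 2 * (-(z.2 ^ m₁) * X ^ 2 + z.1 ^ m₂ * Y ^ 2) + F) =
      1 / 2 * (-z.2) ^ ((m₁ : ℝ) / 2) *
        ((-z.2) ^ ((m₁ : ℝ) / 2) * X + z.1 ^ ((m₂ : ℝ) / 2) * Y) ^ 2 +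
        (-z.2) ^ ((m₁ : ℝ) / 2) * F := by
  have h1 := rpow_half_sq m₁ (t := -z.2) (by linarith)
  rw [hm₁.neg_pow] at h1
  rw [← h1, ← rpow_half_sq m₂ hx]
  ring

/-- The energy flux through a characteristic parallel to `BC` dominates the potential. -/
theorem le_char_flux {m₁ : ℕ} (hm₁ : Odd m₁) (m₂ : ℕ) {z : ℝ × ℝ} (hx : 0 ≤ z.1) (hy : z.2 ≤ 0)
    (X Y F : ℝ) :
    (-z.2) ^ ((m₁ : ℝ) / 2) * F ≤
      -(z.1 ^ ((m₂ : ℝ) / 2)) * (-(z.2 ^ m₁) * (X * Y)) + (-z.2) ^ ((m₁ : ℝ) / 2) *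
        (1 / 2 * (-(z.2 ^ m₁) * X ^ 2 + z.1 ^ m₂ * Y ^ 2) + F) := by
  have h := char_flux_eq hm₁ m₂ hx hy X (-Y) F
  have hk : 0 ≤ (-z.2) ^ ((m₁ : ℝ) / 2) := Real.rpow_nonneg (by linarith) _
  have hsq := mul_nonneg (mul_nonneg (by norm_num : (0 : ℝ) ≤ 1 / 2) hk)
    (sq_nonneg ((-z.2) ^ ((m₁ : ℝ) / 2) * X + z.1 ^ ((m₂ : ℝ) / 2) * -Y))
  rw [neg_sq] at h
  linarith

/-- Solutions have small energy flux through the boundary pieces carrying the data. -/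
theorem exists_flux_lt {m₁ : ℕ} (hm₁ : Odd m₁) (m₂ : ℕ) {y₀ : ℝ} (hy₀ : y₀ < 0) {α : ℝ}
    (hα : -1 < α) {u : ℝ × ℝ → ℝ} (hu : IsRegularSolution m₁ m₂ α (triangle m₁ m₂ y₀)
      (arcAC m₁ m₂ y₀ ∪ segAB y₀) u) {σ : ℝ} (hσ : 0 < σ) :
    ∃ δ > 0, ∀ z ∈ triangle m₁ m₂ y₀,
      (z.1 < δ → |fluxX m₁ u z| < σ) ∧
      (charCoord m₁ (-(2 * y₀)) - (charCoord m₂ z.1 + charCoord m₁ (-z.2)) < δ →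
        |z.1 ^ ((m₂ : ℝ) / 2) * fluxX m₁ u z +
          (-z.2) ^ ((m₁ : ℝ) / 2) * energy m₁ m₂ α u z| < σ) := by
  obtain ⟨g, hg, hgu⟩ := hu.regular.ext_fderiv
  have hud := hu.regular.contDiffOn.differentiableOn two_ne_zero
  have huc := hu.regular.continuousOn
  have hK := isCompact_closure_triangle m₁ m₂ hy₀
  have hg1 : ∀ v : ℝ × ℝ, ContinuousOn (fun z => g z v) (closure (triangle m₁ m₂ y₀)) :=
    fun v => hg.clm_apply continuousOn_const
  have hy : Continuous fun z : ℝ × ℝ => -(z.2 ^ m₁) := by fun_prop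
  have hk : Continuous fun z : ℝ × ℝ => (-z.2) ^ ((m₁ : ℝ) / 2) :=
    (continuous_rpow_half m₁).comp continuous_snd.neg
  have hp : Continuous fun z : ℝ × ℝ => z.1 ^ ((m₂ : ℝ) / 2) :=
    (continuous_rpow_half m₂).comp continuous_fst
  have hη : Continuous fun z : ℝ × ℝ =>
      charCoord m₁ (-(2 * y₀)) - (charCoord m₂ z.1 + charCoord m₁ (-z.2)) :=
    continuous_const.sub (((continuous_charCoord m₂).comp continuous_fst).add
      ((continuous_charCoord m₁).comp continuous_snd.neg))
  have hcl := closure_triangle m₁ m₂ hy₀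
  obtain ⟨δ₁, hδ₁, h₁⟩ := exists_pos_forall_abs_lt hK
    (G := fun z => -(z.2 ^ m₁) * (g z (1, 0) * g z (0, 1))) (H := fun z => z.1)
    (hy.continuousOn.mul ((hg1 (1, 0)).mul (hg1 (0, 1)))) continuous_fst.continuousOn
    (fun z hz => by rw [hcl] at hz; exact hz.1)
    (fun z hz hz0 => by
      simp only [trace_segAB m₁ m₂ hy₀ hud huc hg hgu
        (fun z hz => hu.boundary z (Or.inr hz)) hz hz0, mul_zero]) hσ
  obtain ⟨δ₂, hδ₂, h₂⟩ := exists_pos_forall_abs_lt hK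
    (G := fun z => 1 / 2 * (-z.2) ^ ((m₁ : ℝ) / 2) *
        ((-z.2) ^ ((m₁ : ℝ) / 2) * g z (1, 0) + z.1 ^ ((m₂ : ℝ) / 2) * g z (0, 1)) ^ 2 +
        (-z.2) ^ ((m₁ : ℝ) / 2) * potential α (u z))
    (H := fun z => charCoord m₁ (-(2 * y₀)) - (charCoord m₂ z.1 + charCoord m₁ (-z.2)))
    (((continuous_const.mul hk).continuousOn.mul (((hk.continuousOn.mul (hg1 (1, 0))).add
      (hp.continuousOn.mul (hg1 (0, 1)))).pow 2)).add
      (hk.continuousOn.mul ((continuous_potential hα).comp_continuousOn huc)))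
    hη.continuousOn
    (fun z hz => by
      rw [hcl] at hz
      linarith [hz.2.2.2])
    (fun z hz hz0 => by
      obtain ⟨e1, e2⟩ := trace_arcAC m₁ m₂ hy₀ hud huc hg hgu
        (fun z hz => hu.boundary z (Or.inl hz)) hz (by linarith)
      simp only [e1, e2, potential_zero hα]
      ring) hσ
  refine ⟨min δ₁ δ₂, lt_min hδ₁ hδ₂, fun z hz => ⟨fun hlt => ?_, fun hlt => ?_⟩⟩
  · have h := h₁ z (subset_closure hz) (hlt.trans_le (min_le_left _ _))
    rwa [hgu hz] at h
  · have h := h₂ z (subset_closure hz) (hlt.trans_le (min_le_right _ _))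
    rw [hgu hz] at h
    have h' := char_flux_eq hm₁ m₂ hz.1.le hz.2.1.le (dx u z) (dy u z) (potential α (u z))
    rw [fluxX, energy, h']
    exact h

/-- The divergence of the energy flux multiplied by the cutoff is bounded from below by the part in
which the derivative falls on the increasing factor of the cutoff. -/
theorem cutoff_flux_ge {m₁ : ℕ} (hm₁ : Odd m₁) (m₂ : ℕ) {y₀ : ℝ} {α : ℝ}
    (hα : -1 < α) {u : ℝ × ℝ → ℝ} (hu : ContDiffOn ℝ 2 u (triangle m₁ m₂ y₀))
    (heq : ∀ z ∈ triangle m₁ m₂ y₀, op m₁ m₂ u z = u z * |u z| ^ (α - 1)) {σ ε c : ℝ}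
    (hε : 0 < ε) (hc : 0 ≤ c) {z : ℝ × ℝ} (hz : z ∈ triangle m₁ m₂ y₀)
    (hσ₁ : z.1 ≤ 2 * ε → |fluxX m₁ u z| ≤ σ)
    (hσ₂ : charCoord m₁ (-(2 * y₀)) - (charCoord m₂ z.1 + charCoord m₁ (-z.2)) ≤ 2 * ε →
        |z.1 ^ ((m₂ : ℝ) / 2) * fluxX m₁ u z +
          (-z.2) ^ ((m₁ : ℝ) / 2) * energy m₁ m₂ α u z| ≤ σ) :
    step ((z.1 - ε) / ε) *
        step ((charCoord m₁ (-(2 * y₀)) - (charCoord m₂ z.1 + charCoord m₁ (-z.2)) - ε) / ε) *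
        (2 * max (charCoord m₁ (-z.2) - charCoord m₂ z.1 - c) 0) *
        ((-z.2) ^ ((m₁ : ℝ) / 2) * potential α (u z)) -
      {z ∈ triangle m₁ m₂ y₀ | z.1 ≤ 2 * ε}.indicator
        (fun _ => 1 / ε * (1 / 2) * charCoord m₁ (-(2 * y₀)) ^ 2 * σ) z -
      {z ∈ triangle m₁ m₂ y₀ |
        charCoord m₁ (-(2 * y₀)) - (charCoord m₂ z.1 + charCoord m₁ (-z.2)) ≤ 2 * ε}.indicator
        (fun _ => 1 / ε * (1 / 2) * charCoord m₁ (-(2 * y₀)) ^ 2 * σ) z ≤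
      fderiv ℝ (fun z => cutoff m₁ m₂ (charCoord m₁ (-(2 * y₀))) ε c z * fluxX m₁ u z) z (1, 0) -
      fderiv ℝ (fun z => cutoff m₁ m₂ (charCoord m₁ (-(2 * y₀))) ε c z *
        energy m₁ m₂ α u z) z (0, 1) := by
  set S := charCoord m₁ (-(2 * y₀)) with hS
  have hΩ := isOpen_triangle m₁ m₂ y₀
  have hφ := ((contDiff_cutoff m₁ m₂ S ε c).differentiable one_ne_zero z).hasFDerivAt
  have hP := (((contDiffOn_fluxX (m₁ := m₁) hΩ hu).differentiableOn one_ne_zero z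
    hz).differentiableAt (hΩ.mem_nhds hz)).hasFDerivAt
  have he := (((contDiffOn_energy hα hΩ hu heq).differentiableOn one_ne_zero z
    hz).differentiableAt (hΩ.mem_nhds hz)).hasFDerivAt
  have hdiv := dx_fluxX_sub_dy_energy hα hΩ hu heq hz
  have hgrad := dx_cutoff_mul_sub m₁ m₂ S ε c z (fluxX m₁ u z) (energy m₁ m₂ α u z)
  rw [(hφ.fun_mul hP).fderiv, (hφ.fun_mul he).fderiv]
  simp only [add_apply, smul_apply, smul_eq_mul]
  unfold dx dy at hdiv hgrad
  have hpos : 0 ≤ cutoff m₁ m₂ S ε c z * (1 / 2 * (m₁ * z.2 ^ (m₁ - 1)) *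
      fderiv ℝ u z (1, 0) ^ 2) := by
    have heven : Even (m₁ - 1) := Nat.Odd.sub_odd hm₁ odd_one
    have := heven.pow_nonneg z.2
    exact mul_nonneg (cutoff_nonneg m₁ m₂ S ε c z) (by positivity)
  have hk := le_char_flux hm₁ m₂ hz.1.le hz.2.1.le (dx u z) (dy u z) (potential α (u z))
  have hk' : (-z.2) ^ ((m₁ : ℝ) / 2) * potential α (u z) ≤
      -(z.1 ^ ((m₂ : ℝ) / 2)) * fluxX m₁ u z + (-z.2) ^ ((m₁ : ℝ) / 2) * energy m₁ m₂ α u z := hk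
  have hSpos : 0 ≤ S := by
    obtain ⟨h1, h2, h3, h4⟩ := hz
    linarith [charCoord_pos m₂ h1]
  have hW : max (charCoord m₁ (-z.2) - charCoord m₂ z.1 - c) 0 ^ 2 ≤ S ^ 2 := by
    refine pow_le_pow_left₀ (le_max_right _ _) (max_le ?_ hSpos) 2
    obtain ⟨h1, h2, h3, h4⟩ := hz
    linarith [charCoord_pos m₂ h1]
  set W := max (charCoord m₁ (-z.2) - charCoord m₂ z.1 - c) 0 ^ 2 with hWdef
  have hW0 : 0 ≤ W := sq_nonneg _
  set A := (z.1 - ε) / ε with hA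
  set B := (S - (charCoord m₂ z.1 + charCoord m₁ (-z.2)) - ε) / ε with hB
  have hA0 := step_mem_Icc A
  have hB0 := step_mem_Icc B
  have hA1 := stepDeriv_mem_Icc A
  have hB1 := stepDeriv_mem_Icc B
  set M := 1 / ε * (1 / 2) * S ^ 2 * σ with hM
  have hprod : ∀ d s v : ℝ, d ∈ Icc (0 : ℝ) 1 → s ∈ Icc (0 : ℝ) (1 / 2) → |v| ≤ σ →
      |d / ε * s * W * v| ≤ M := by
    intro d s v hd hs hv
    have e1 : d / ε ≤ 1 / ε := div_le_div_of_nonneg_right hd.2 hε.le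
    have e0 : 0 ≤ d / ε := div_nonneg hd.1 hε.le
    rw [abs_mul, abs_of_nonneg (mul_nonneg (mul_nonneg e0 hs.1) hW0)]
    exact mul_le_mul (mul_le_mul (mul_le_mul e1 hs.2 hs.1 (by positivity)) hW hW0 (by positivity))
      hv (abs_nonneg _) (by positivity)
  have hT1 : |stepDeriv A / ε * step B * W * fluxX m₁ u z| ≤
      {z ∈ triangle m₁ m₂ y₀ | z.1 ≤ 2 * ε}.indicator (fun _ => M) z := by
    by_cases h : z.1 ≤ 2 * ε
    · have hmem : z ∈ {z ∈ triangle m₁ m₂ y₀ | z.1 ≤ 2 * ε} := ⟨hz, h⟩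
      rw [indicator_of_mem hmem]
      exact hprod _ _ _ hA1 hB0 (hσ₁ h)
    · rw [indicator_of_notMem fun h' => h h'.2,
        stepDeriv_of_one_le ((one_le_div hε).2 (by linarith))]
      simp
  have hT2 : |stepDeriv B / ε * step A * W * (z.1 ^ ((m₂ : ℝ) / 2) * fluxX m₁ u z +
      (-z.2) ^ ((m₁ : ℝ) / 2) * energy m₁ m₂ α u z)| ≤
      {z ∈ triangle m₁ m₂ y₀ |
        S - (charCoord m₂ z.1 + charCoord m₁ (-z.2)) ≤ 2 * ε}.indicator (fun _ => M) z := by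
    by_cases h : S - (charCoord m₂ z.1 + charCoord m₁ (-z.2)) ≤ 2 * ε
    · have hmem : z ∈ {z ∈ triangle m₁ m₂ y₀ |
          S - (charCoord m₂ z.1 + charCoord m₁ (-z.2)) ≤ 2 * ε} := ⟨hz, h⟩
      rw [indicator_of_mem hmem]
      exact hprod _ _ _ hB1 hA0 (hσ₂ h)
    · rw [indicator_of_notMem fun h' => h h'.2,
        stepDeriv_of_one_le ((one_le_div hε).2 (by linarith))]
      simp
  have hT3 := mul_le_mul_of_nonneg_left hk' (mul_nonneg (mul_nonneg hA0.1 hB0.1)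
    (mul_nonneg zero_le_two (le_max_right (charCoord m₁ (-z.2) - charCoord m₂ z.1 - c) 0)))
  have hdiv' := congrArg (cutoff m₁ m₂ S ε c z * ·) hdiv
  rw [mul_sub] at hdiv'
  rw [mul_comm (stepDeriv B / ε) (step A)] at hT2
  linarith [neg_le_of_abs_le hT1, le_of_abs_le hT2]

/-- Uniqueness for the mixed characteristic problem, for every exponent for which the potential is
defined and nonnegative. -/
theorem eq_zero_of_isRegularSolution {m₁ : ℕ} (hm₁ : Odd m₁) (m₂ : ℕ) {y₀ : ℝ} (hy₀ : y₀ < 0)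
    {α : ℝ} (hα : -1 < α) {u : ℝ × ℝ → ℝ}
    (hu : IsRegularSolution m₁ m₂ α (triangle m₁ m₂ y₀) (arcAC m₁ m₂ y₀ ∪ segAB y₀) u)
    {z₀ : ℝ × ℝ} (hz₀ : z₀ ∈ triangle m₁ m₂ y₀) : u z₀ = 0 := by
  by_contra hne
  have hΩ := isOpen_triangle m₁ m₂ y₀
  have hK := isCompact_closure_triangle m₁ m₂ hy₀
  have hS := charCoord_pos m₁ (t := -(2 * y₀)) (by linarith)
  obtain ⟨C, hC0, hC⟩ := volume_strip_AC_le m₁ m₂ hy₀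
  set S := charCoord m₁ (-(2 * y₀)) with hSdef
  have hRc : Continuous fun z : ℝ × ℝ => charCoord m₂ z.1 :=
    (continuous_charCoord m₂).comp continuous_fst
  have hSc : Continuous fun z : ℝ × ℝ => charCoord m₁ (-z.2) :=
    (continuous_charCoord m₁).comp continuous_snd.neg
  let ξ : ℝ × ℝ → ℝ := fun z => charCoord m₁ (-z.2) - charCoord m₂ z.1
  have hξc : Continuous ξ := hSc.sub hRc
  let θ : ℝ × ℝ → ℝ := fun z => S - (charCoord m₂ z.1 + charCoord m₁ (-z.2))
  have hθc : Continuous θ := continuous_const.sub (hRc.add hSc)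
  have hξ₀ : 0 < ξ z₀ := sub_pos.2 hz₀.2.2.1
  have hθ₀ : 0 < θ z₀ := by
    have h : charCoord m₂ z₀.1 < S - charCoord m₁ (-z₀.2) := hz₀.2.2.2
    simp only [θ]
    linarith
  set c := ξ z₀ / 2 with hc
  -- The limit of the main term as the cutoff becomes sharp.
  let m : ℝ × ℝ → ℝ := fun z =>
    1 / 2 * (1 / 2) * (2 * max (ξ z - c) 0) * ((-z.2) ^ ((m₁ : ℝ) / 2) * potential α (u z))
  have hmc : ContinuousAt m z₀ := by
    have h1 : ContinuousAt u z₀ :=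
      hu.regular.contDiffOn.continuousOn.continuousAt (hΩ.mem_nhds hz₀)
    have h2 : Continuous fun z : ℝ × ℝ => (-z.2) ^ ((m₁ : ℝ) / 2) :=
      (continuous_rpow_half m₁).comp continuous_snd.neg
    exact (continuous_const.mul (continuous_const.mul
      ((hξc.sub continuous_const).max continuous_const))).continuousAt.mul
      (h2.continuousAt.mul ((continuous_potential hα).continuousAt.comp h1))
  have hm₀ : 0 < m z₀ := by
    have h1 : 0 < max (ξ z₀ - c) 0 := lt_max_of_lt_left (by linarith)
    have h2 : 0 < (-z₀.2) ^ ((m₁ : ℝ) / 2) :=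
      Real.rpow_pos_of_pos (neg_pos.2 hz₀.2.1) _
    have h3 := potential_pos hα hne
    simp only [m]
    positivity
  set μ := m z₀ / 2 with hμ
  obtain ⟨B, hBsub, hBo, hzB⟩ := eventually_nhds_iff.1
    ((hΩ.eventually_mem hz₀).and (((hmc.eventually (Ioi_mem_nhds (half_lt_self hm₀))).and
      ((continuous_fst.tendsto z₀).eventually (Ioi_mem_nhds (half_lt_self hz₀.1)))).and
      ((hθc.tendsto z₀).eventually (Ioi_mem_nhds (half_lt_self hθ₀)))))
  have hfin : ∀ s : Set (ℝ × ℝ), s ⊆ triangle m₁ m₂ y₀ → volume s ≠ ⊤ := fun s hs =>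
    ((measure_mono (hs.trans subset_closure)).trans_lt hK.measure_lt_top).ne
  have hBΩ : B ⊆ triangle m₁ m₂ y₀ := fun z hz => (hBsub z hz).1
  have hBpos : 0 < volume.real B :=
    ENNReal.toReal_pos (hBo.measure_pos volume ⟨z₀, hzB⟩).ne' (hfin B hBΩ)
  set L := -(4 * y₀) + C with hL
  have hLpos : 0 < L := by linarith
  set σ := μ * volume.real B / (S ^ 2 * L) with hσdef
  have hσ : 0 < σ := by positivity
  obtain ⟨δ, hδ, hflux⟩ := exists_flux_lt hm₁ m₂ hy₀ hα hu hσ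
  obtain ⟨ε, hε, hεb⟩ : ∃ ε > 0, ε < min (min (δ / 2) (S / 4)) (min (z₀.1 / 4) (θ z₀ / 4)) :=
    exists_between (lt_min (lt_min (by positivity) (by positivity))
      (lt_min (by linarith [hz₀.1]) (by positivity)))
  rw [lt_min_iff, lt_min_iff, lt_min_iff] at hεb
  obtain ⟨⟨hε1, hε2⟩, hε3, hε4⟩ := hεb
  set M := 1 / ε * (1 / 2) * S ^ 2 * σ with hM
  set E₁ := {z ∈ triangle m₁ m₂ y₀ | z.1 ≤ 2 * ε} with hE₁
  set E₂ := {z ∈ triangle m₁ m₂ y₀ |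
    S - (charCoord m₂ z.1 + charCoord m₁ (-z.2)) ≤ 2 * ε} with hE₂
  set K := closure (triangle m₁ m₂ y₀) ∩ {z | ε ≤ z.1 ∧ ε ≤ θ z ∧ c ≤ ξ z} with hKdef
  have hKc : IsCompact K := hK.inter_right
    ((isClosed_le continuous_const continuous_fst).inter
      ((isClosed_le continuous_const hθc).inter (isClosed_le continuous_const hξc)))
  have hKΩ : K ⊆ triangle m₁ m₂ y₀ := by
    rintro z ⟨hz, h1, h2, h3⟩
    rw [closure_triangle m₁ m₂ hy₀] at hz
    obtain ⟨g1, g2, -, -⟩ := hz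
    simp only [θ, ξ] at h2 h3
    have hlt : charCoord m₂ z.1 < charCoord m₁ (-z.2) := by linarith
    refine ⟨by linarith, lt_of_le_of_ne g2 fun h0 => ?_, hlt, ?_⟩
    · rw [h0, neg_zero, charCoord_zero] at hlt
      linarith [charCoord_nonneg m₂ g1]
    · rw [← hSdef]
      linarith
  have hφ0 : ∀ z ∈ triangle m₁ m₂ y₀, z ∉ K → cutoff m₁ m₂ S ε c z = 0 := by
    intro z hz hzK
    refine cutoff_eq_zero m₁ m₂ S c hε ?_
    by_contra! hcon
    refine hzK ⟨subset_closure hz, hcon.1.le, ?_, hcon.2.2.le⟩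
    simp only [θ]
    linarith [hcon.2.1]
  have hφc := (contDiff_cutoff m₁ m₂ S ε c).contDiffOn (s := triangle m₁ m₂ y₀)
  obtain ⟨i1, e1⟩ := integral_indicator_fderiv_eq_zero hΩ hKc hKΩ
    (hφc.mul (contDiffOn_fluxX (m₁ := m₁) hΩ hu.regular.contDiffOn))
    (fun z hz hzK => by rw [hφ0 z hz hzK, zero_mul]) (1, 0)
  obtain ⟨i2, e2⟩ := integral_indicator_fderiv_eq_zero hΩ hKc hKΩ
    (hφc.mul (contDiffOn_energy hα hΩ hu.regular.contDiffOn hu.eqn))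
    (fun z hz hzK => by rw [hφ0 z hz hzK, zero_mul]) (0, 1)
  have hE₁m : MeasurableSet E₁ := hΩ.measurableSet.inter
    (isClosed_le continuous_fst continuous_const).measurableSet
  have hE₂m : MeasurableSet E₂ := hΩ.measurableSet.inter
    (isClosed_le hθc continuous_const).measurableSet
  have hmain := le_integral_of_indicator_le (i1.sub i2) hBo.measurableSet hE₁m hE₂m (hfin B hBΩ)
    (hfin E₁ fun z hz => hz.1) (hfin E₂ fun z hz => hz.1) (c := μ) (M := M) (fun z => by
      by_cases hz : z ∈ triangle m₁ m₂ y₀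
      · rw [Pi.sub_apply, indicator_of_mem hz, indicator_of_mem hz]
        refine le_trans ?_ (cutoff_flux_ge hm₁ m₂ hα hu.regular.contDiffOn hu.eqn (σ := σ) hε
          (half_pos hξ₀).le hz (fun h => ((hflux z hz).1 (by linarith)).le)
          (fun h => ((hflux z hz).2 (by linarith)).le))
        refine sub_le_sub_right (sub_le_sub_right ?_ _) _
        by_cases hzB' : z ∈ B
        · obtain ⟨-, ⟨h1, h2⟩, h3⟩ := hBsub z hzB'
          rw [indicator_of_mem hzB', step_of_one_le ((one_le_div hε).2 (by linarith)),
            step_of_one_le ((one_le_div hε).2 (by simp only [θ] at h3; linarith))]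
          exact h1.le
        · rw [indicator_of_notMem hzB']
          exact mul_nonneg (mul_nonneg (mul_nonneg (step_mem_Icc _).1 (step_mem_Icc _).1)
            (mul_nonneg zero_le_two (le_max_right _ _)))
            (mul_nonneg (Real.rpow_nonneg (neg_nonneg.2 hz.2.1.le) _) (potential_nonneg hα _))
      · rw [Pi.sub_apply, indicator_of_notMem hz, indicator_of_notMem hz,
          indicator_of_notMem fun h => hz (hBΩ h), indicator_of_notMem fun h => hz h.1,
          indicator_of_notMem fun h => hz h.1]
        simp)
  rw [integral_sub' i1 i2, e1, e2] at hmain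
  have hv1 : volume.real E₁ ≤ -(4 * y₀) * ε := volume_strip_AB_le m₁ m₂ hy₀ hε
  have hv2 : volume.real E₂ ≤ C * ε := hC ε hε hε2.le
  have hMpos : 0 < M := by positivity
  have hbound : M * (volume.real E₁ + volume.real E₂) ≤ M * (L * ε) :=
    mul_le_mul_of_nonneg_left (by rw [hL]; linarith) hMpos.le
  -- The width `ε` of the strips cancels against the slope `1 / ε` of the cutoff.
  have hval : M * (L * ε) = μ * volume.real B / 2 := by
    rw [hM, hσdef]
    field_simp
  have : 0 < μ * volume.real B := by positivity
  linarith

end Tricomi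

theorem theorem4 (m₁ m₂ : ℕ) (hm₁ : Odd m₁) (hm₂ : Even m₂) (y₀ : ℝ) (hy₀ : y₀ < 0)
    (hstar : Tricomi.DStarShaped ((m₁ : ℝ) + 2) ((m₂ : ℝ) + 2) (Tricomi.triangle m₁ m₂ y₀))
    (α : ℝ) (hα : Tricomi.critExp m₁ m₂ - 1 < α) (u : ℝ × ℝ → ℝ)
    (hu : Tricomi.IsRegularSolution m₁ m₂ α (Tricomi.triangle m₁ m₂ y₀)
      (Tricomi.arcAC m₁ m₂ y₀ ∪ Tricomi.segAB y₀) u) :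
    ∀ z ∈ Tricomi.triangle m₁ m₂ y₀, u z = 0 := by
  have hcrit : 0 ≤ Tricomi.critExp m₁ m₂ := by
    unfold Tricomi.critExp
    positivity
  exact fun z hz => Tricomi.eq_zero_of_isRegularSolution hm₁ m₂ hy₀ (by linarith) hu hz
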